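/- Let $\mathbf x:\mathbb R\to\mathbb R^2$ be a real-analytic, $2\pi$-periodic, regular ($\mathbf x'(t)\neq 0$ for all $t$) and counterclockwise parametrization of a simple closed curve $\Gamma$ (so $\mathbf x$ is injective on $[0,2\pi)$), with unit normal $\mathbf n(t)=(\mathrm x_2'(t),-\mathrm x_1'(t))/|\mathbf x'(t)|$, and let $\phi:\mathbb R\to\mathbb R$ be real-analytic and $2\pi$-periodic. With $G(x,y)=-\frac1{2\pi}\log|x-y|$, let $$\tilde N[\phi](t)=\mathrm{f.p.}\int_0^{2\pi}\frac{\partial^2 G(\mathbf x(t),\mathbf x(\tau))}{\partial \mathbf n(t)\,\partial \mathbf n(\tau)}\,\phi(\tau)\,|\mathbf x'(\tau)|\,d\tau$$ be the hypersingular operator, where the Hadamard finite part is the number $b$ such that the integral over $\{\tau\in[0,2\pi):|\mathbf x(t)-\mathbf x(\tau)|>\varepsilon\}$ equals $a/\varepsilon+b+o(1)$ as $\varepsilon\to0^+$ for some constant $a$. Let $U_N:\mathbb R^2\times\Gamma\to\mathbb R$ be such that $U_N(\cdot,y)$ is harmonic in $\mathbb R^2$ for every $y\in\Gamma$, put $$P_N(\tau,t)=U_N(\mathbf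 x(\tau),\mathbf x(t)),\qquad Q_N(\tau,t)=\nabla U_N(\mathbf x(\tau),\mathbf x(t))\cdot\mathbf n(\tau)$$ (gradient in the first variable), and suppose that for some integer $M\ge 1$ and all $t$ $$\lim_{\tau\to t}\frac{\partial^m}{\partial\tau^m}\{P_N(\tau,t)-\phi(\tau)\}=0,\qquad m=0,\dots,M.$$ Then for every $t$ the finite part $\tilde N[\phi](t)$ exists and $$\tilde N[\phi](t)=-\frac{Q_N(t,t)}2+\int_0^{2\pi}\left\{R_N^{(P)}(\tau,t)+R_N^{(Q)}(\tau,t)\right\}|\mathbf x'(\tau)|\,d\tau,$$ where $$R_N^{(P)}(\tau,t)=\begin{cases}\left(\dfrac{\mathbf n(\tau)\cdot\mathbf n(t)}{2\pi|\mathbf x(t)-\mathbf x(\tau)|^2}-\dfrac{\{\mathbf x(t)-\mathbf x(\tau)\}\cdot\mathbf n(t)\,\{\mathbf x(t)-\mathbf x(\tau)\}\cdot\mathbf n(\tau)}{\pi|\mathbf x(t)-\mathbf x(\tau)|^4}\right)\{\phi(\tau)-P_N(\tau,t)\}, & \tau\not\equiv t \pmod{2\pi},\\[2ex] \dfrac1{4\pi|\mathbf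 x'(t)|^2}\,\dfrac{\partial^2}{\partial s^2}\{\phi(s)-P_N(s,t)\}\Big|_{s=t}, & \tau\equiv t\pmod{2\pi},\end{cases}$$ $$R_N^{(Q)}(\tau,t)=\begin{cases}-\dfrac1{2\pi}\dfrac{\{\mathbf x(t)-\mathbf x(\tau)\}\cdot\mathbf n(t)}{|\mathbf x(t)-\mathbf x(\tau)|^2}\,Q_N(\tau,t), & \tau\not\equiv t\pmod{2\pi},\\[2ex] \dfrac{\mathbf x''(t)\cdot\mathbf n(t)}{4\pi|\mathbf x'(t)|^2}\,Q_N(t,t), & \tau\equiv t\pmod{2\pi},\end{cases}$$ and, for every $t$, both $R_N^{(P)}(\cdot,t)$ and $R_N^{(Q)}(\cdot,t)$ are real-analytic $2\pi$-periodic functions of $\tau\in\mathbb R$. -/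

import Mathlib

noncomputable section

namespace HDI

open Filter Topology Set

/-- The Euclidean plane. -/
abbrev Plane : Type := EuclideanSpace ℝ (Fin 2)

/-- Winding number about `p` of the `2π`-periodic closed curve parametrized by `x`. -/
def windingNumber (x : ℝ → Plane) (p : Plane) : ℝ :=
  (1 / (2 * Real.pi)) * ∫ τ in (0 : ℝ)..(2 * Real.pi),
    ((x τ 0 - p 0) * deriv x τ 1 - (x τ 1 - p 1) * deriv x τ 0) / ‖x τ - p‖ ^ 2

/-- `x` is a regular, analytic, `2π`-periodic, counterclockwise parametrization of a simple closed
curve. The winding number of a simple closed curve is `0` about the exterior points, and it is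
either `1` about all interior points (counterclockwise) or `-1` about all of them (clockwise);
hence a simple closed curve is counterclockwise iff its winding number is `1` about some point. -/
structure IsAnalyticSimpleClosedCurve (x : ℝ → Plane) : Prop where
  analytic : AnalyticOnNhd ℝ x univ
  periodic : Function.Periodic x (2 * Real.pi)
  regular : ∀ t, deriv x t ≠ 0
  simple : InjOn x (Ico 0 (2 * Real.pi))
  counterclockwise : ∃ p, p ∉ range x ∧ windingNumber x p = 1

/-- The unit normal `(x₂', -x₁') / |x'|`, outward for a counterclockwise curve. -/
def normal (x : ℝ → Plane) (t : ℝ) : Plane :=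
  ‖deriv x t‖⁻¹ • !₂[deriv x t 1, -deriv x t 0]

/-- The free-space Green function of the Laplace equation in the plane. -/
def green (p q : Plane) : ℝ := -(1 / (2 * Real.pi)) * Real.log ‖p - q‖

/-- The kernel `∂²G(p, q) / ∂n(p) ∂n(q)` at `p = x(t)`, `q = x(τ)`. -/
def hypersingularKernel (x : ℝ → Plane) (τ t : ℝ) : ℝ :=
  fderiv ℝ (fun p => fderiv ℝ (fun q => green p q) (x τ) (normal x τ)) (x t) (normal x t)

/-- The integral of `(∂²G / ∂n(x(t)) ∂n(y)) φ(y)` against arc length over the part of the curve at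
distance larger than `ε` from the point `x(t)`. -/
def truncatedHypersingular (x : ℝ → Plane) (φ : ℝ → ℝ) (t ε : ℝ) : ℝ :=
  ∫ τ in {τ | τ ∈ Ico 0 (2 * Real.pi) ∧ ε < ‖x t - x τ‖},
    hypersingularKernel x τ t * φ τ * ‖deriv x τ‖

/-- `b` is the Hadamard finite part at `ε → 0⁺` of the truncated integrals `I ε` of an integrand
with a second-order singularity: `I ε = a / ε + b + o(1)` for some constant `a`. -/
def HasFinitePart (I : ℝ → ℝ) (b : ℝ) : Prop :=
  ∃ a : ℝ, Tendsto (fun ε => I ε - a / ε) (𝓝[>] 0) (𝓝 b)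

theorem HasFinitePart.unique {I : ℝ → ℝ} {b c : ℝ}
    (hb : HasFinitePart I b) (hc : HasFinitePart I c) : b = c := by
  obtain ⟨a, ha⟩ := hb
  obtain ⟨d, hd⟩ := hc
  have h1 : Tendsto (fun ε : ℝ => (d - a) / ε) (𝓝[>] 0) (𝓝 (b - c)) := by
    refine (ha.sub hd).congr fun ε => ?_
    ring
  have h0 : Tendsto (fun ε : ℝ => ε) (𝓝[>] 0) (𝓝 0) := nhdsWithin_le_nhds
  have h2 : Tendsto (fun ε : ℝ => (d - a) / ε * ε) (𝓝[>] 0) (𝓝 0) := by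
    simpa using h1.mul h0
  have h3 : Tendsto (fun _ : ℝ => d - a) (𝓝[>] (0 : ℝ)) (𝓝 0) := by
    refine h2.congr' ?_
    filter_upwards [self_mem_nhdsWithin] with ε hε
    exact div_mul_cancel₀ _ (ne_of_gt hε)
  have h4 : d - a = 0 := tendsto_nhds_unique tendsto_const_nhds h3
  have h5 : Tendsto (fun _ : ℝ => (0 : ℝ)) (𝓝[>] (0 : ℝ)) (𝓝 (b - c)) := by
    simpa [h4] using h1
  linarith [tendsto_nhds_unique tendsto_const_nhds h5]

/-- The hypersingular operator, in the parameter space, applied to the density `φ` and evaluated at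
`t` exists (as a Hadamard finite part) and has the value `v`; such a `v` is unique. -/
def HasHypersingularValue (x : ℝ → Plane) (φ : ℝ → ℝ) (t v : ℝ) : Prop :=
  HasFinitePart (truncatedHypersingular x φ t) v

/-- Dirichlet trace `P(τ, t) = U(x(τ), x(t))`. -/
def dirichletTrace (x : ℝ → Plane) (U : Plane → range x → ℝ) (τ t : ℝ) : ℝ :=
  U (x τ) ⟨x t, mem_range_self t⟩

/-- Neumann trace `Q(τ, t) = ∇U(x(τ), x(t)) · n(τ)`, the gradient being taken in the first
variable. -/
def neumannTrace (x : ℝ → Plane) (U : Plane → range x → ℝ) (τ t : ℝ) : ℝ :=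
  inner ℝ (gradient (fun p => U p ⟨x t, mem_range_self t⟩) (x τ)) (normal x τ)

/-- `P(·, t)` matches `φ` to order `M` at `τ = t`, for every `t`. -/
def InterpolatesToOrder (M : ℕ) (P : ℝ → ℝ → ℝ) (φ : ℝ → ℝ) : Prop :=
  ∀ t : ℝ, ∀ m ≤ M,
    Tendsto (iteratedDeriv m (fun τ => P τ t - φ τ)) (𝓝[≠] t) (𝓝 0)

/-- `τ` and `t` are the same parameter modulo `2π`. -/
def SameParam (τ t : ℝ) : Prop := ∃ k : ℤ, τ = t + k * (2 * Real.pi)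

open Classical in
/-- The kernel `R_N^{(P)}(τ, t)`, with its diagonal value at `τ ≡ t` modulo `2π`. -/
def kernelP (x : ℝ → Plane) (φ : ℝ → ℝ) (U : Plane → range x → ℝ) (τ t : ℝ) : ℝ :=
  if SameParam τ t then
    1 / (4 * Real.pi * ‖deriv x t‖ ^ 2) *
      iteratedDeriv 2 (fun s => φ s - dirichletTrace x U s t) t
  else
    (inner ℝ (normal x τ) (normal x t) / (2 * Real.pi * ‖x t - x τ‖ ^ 2)
      - inner ℝ (x t - x τ) (normal x t) * inner ℝ (x t - x τ) (normal x τ)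
          / (Real.pi * ‖x t - x τ‖ ^ 4))
      * (φ τ - dirichletTrace x U τ t)

open Classical in
/-- The kernel `R_N^{(Q)}(τ, t)`, with its diagonal value at `τ ≡ t` modulo `2π`. -/
def kernelQ (x : ℝ → Plane) (U : Plane → range x → ℝ) (τ t : ℝ) : ℝ :=
  if SameParam τ t then
    inner ℝ (deriv (deriv x) t) (normal x t) / (4 * Real.pi * ‖deriv x t‖ ^ 2)
      * neumannTrace x U t t
  else
    -(1 / (2 * Real.pi)) * (inner ℝ (x t - x τ) (normal x t) / ‖x t - x τ‖ ^ 2)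
      * neumannTrace x U τ t

end HDI

end

/-! Identify the plane with ℂ and write z for the curve, p = z(t), ν for the unit normal at p. The
kernel times |x'| is -(1/2π) Im(ν z'/(z - p)²), and the interpolant U is Re f with f entire,
normalised so that f(p) is real. Adding and subtracting U and the dipole acting on its Neumann data
splits the integrand into the two kernels and a singular part depending on f alone
(`hypersingular_integrand_eq`). The kernels are analytic because φ - P has a double zero at t, and
because (x(t) - x(τ)) · n(t) has one, the tangent being orthogonal to the normal.

The singular part is the integrand of Green's second identity for Re f and a dipole at p. Up to the
derivative of a multiple of Im f · Re(ν/(z - p)) it is -(1/2π) Im(f ν z'/(z - p)²). Insert f = f(p)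
+ f'(p)(z - p) + h(z)(z - p)² with h entire. The h term integrates to zero around the loop. The f(p)
term and the log|z - p| part of the f'(p) term are exact derivatives; cutting both sides at the same
distance ε cancels the logarithms and leaves a multiple of 1/ε (`hasFinitePart_of_primitive`). What
survives is -(1/2π) Re(ν f'(p)) times the total turn of the chord from p; this turn is π, which
gives -Q/2 (`hasFinitePart_dipole`).

That the turn is π (`IsRegularLoop.chordAngle_eq_pi`) is topological. It is an odd multiple of π and
continuous in t, hence constant. At a lowest point of the curve it is at most 2π in absolute value.
At the point nearest to a given q off the curve it differs by at most 2π from the increment of arg(z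
- q) along the loop, which is 2π for a suitable q since the curve is counterclockwise. Only π is
left. -/

noncomputable section

namespace HDI

open Filter Topology Set
open scoped ContDiff

/-! ### Divided differences of analytic functions. -/

section DividedDifference

variable {E : Type*} [NormedAddCommGroup E] [NormedSpace ℝ E]

/-- Removable singularities on the diagonal are resolved by dividing out τ - a: `dslope` is the
quotient completed by the derivative. At a its power series is that of f shifted by one degree. -/
theorem analyticOnNhd_dslope {f : ℝ → E} (hf : AnalyticOnNhd ℝ f univ) (a : ℝ) :
    AnalyticOnNhd ℝ (dslope f a) univ := by
  intro b _
  rcases eq_or_ne b a with rfl | hb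
  · obtain ⟨p, hp⟩ := hf b (mem_univ b)
    exact ⟨_, hp.has_fpower_series_dslope_fslope⟩
  · rw [analyticAt_congr (dslope_eventuallyEq_slope_of_ne f hb)]
    have h1 : AnalyticAt ℝ (fun c : ℝ => (c - a)⁻¹) b :=
      (analyticAt_id.sub analyticAt_const).inv (sub_ne_zero.2 hb)
    exact h1.smul ((hf b (mem_univ b)).sub analyticAt_const)

theorem hasDerivAt_of_analyticOnNhd {f : ℝ → E} (hf : AnalyticOnNhd ℝ f univ) (τ : ℝ) :
    HasDerivAt f (deriv f τ) τ :=
  (hf τ (mem_univ τ)).differentiableAt.hasDerivAt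

theorem deriv_eq_dslope_add {f : ℝ → E} (hf : AnalyticOnNhd ℝ f univ) (a τ : ℝ) :
    deriv f τ = dslope f a τ + (τ - a) • deriv (dslope f a) τ := by
  have hD := hasDerivAt_of_analyticOnNhd (analyticOnNhd_dslope hf a) τ
  have h1 : HasDerivAt (fun s : ℝ => (s - a) • dslope f a s + f a)
      ((τ - a) • deriv (dslope f a) τ + (1 : ℝ) • dslope f a τ) τ :=
    (((hasDerivAt_id τ).sub_const a).smul hD).add_const (f a)
  have h2 : (fun s : ℝ => (s - a) • dslope f a s + f a) = f := by
    funext s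
    rw [sub_smul_dslope, sub_add_cancel]
  rw [h2] at h1
  rw [h1.deriv, one_smul, add_comm]

/-- Differentiating f' = D + (τ - a) D' at a produces D'(a) twice. This factor is the source of the
halves in the diagonal values of the kernels. -/
theorem deriv_deriv_eq_two_smul_deriv_dslope [CompleteSpace E] {f : ℝ → E}
    (hf : AnalyticOnNhd ℝ f univ) (a : ℝ) :
    deriv (deriv f) a = (2 : ℝ) • deriv (dslope f a) a := by
  have hA := analyticOnNhd_dslope hf a
  have hD := hasDerivAt_of_analyticOnNhd hA a
  have hD' := hasDerivAt_of_analyticOnNhd hA.deriv a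
  have h2 : deriv f = fun τ => dslope f a τ + (τ - a) • deriv (dslope f a) τ :=
    funext fun τ => deriv_eq_dslope_add hf a τ
  have h1 := hD.add (((hasDerivAt_id a).sub_const a).smul hD')
  rw [h2]
  refine h1.deriv.trans ?_
  simp [two_smul]

end DividedDifference

/-! ### Logarithmic derivatives and arguments of plane curves. -/

/-- The increment of the argument along a curve in a closed half-plane is at most `π`. -/
theorem abs_integral_im_logDeriv_le {h h' : ℝ → ℂ} {a b : ℝ} (hab : a ≤ b)
    (hd : ∀ τ ∈ Icc a b, HasDerivAt h (h' τ) τ) (hc : ContinuousOn h' (Icc a b))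
    (h0 : ∀ τ ∈ Icc a b, h τ ≠ 0) (c : ℂ) (hc0 : c ≠ 0)
    (hre : ∀ τ ∈ Icc a b, 0 ≤ (c * h τ).re) :
    |∫ τ in a..b, (h' τ / h τ).im| ≤ Real.pi := by
  -- A nonzero number with nonnegative real part avoids the branch cut, so the principal argument of
  -- c h is a primitive of the integrand, with values in [-π/2, π/2].
  have hslit : ∀ τ ∈ Icc a b, c * h τ ∈ Complex.slitPlane := by
    intro τ hτ
    have hne : c * h τ ≠ 0 := mul_ne_zero hc0 (h0 τ hτ)
    rw [Complex.mem_slitPlane_iff]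
    rcases (hre τ hτ).lt_or_eq with hlt | heq
    · exact Or.inl hlt
    · right
      intro him
      exact hne (Complex.ext heq.symm him)
  have hderiv : ∀ τ ∈ Icc a b,
      HasDerivAt (fun s => (Complex.log (c * h s)).im) ((h' τ / h τ).im) τ := by
    intro τ hτ
    have h1 : HasDerivAt (fun s => Complex.log (c * h s)) (c * h' τ / (c * h τ)) τ :=
      ((hd τ hτ).const_mul c).clog_real (hslit τ hτ)
    rw [mul_div_mul_left _ _ hc0] at h1
    exact Complex.imCLM.hasFDerivAt.comp_hasDerivAt τ h1
  have hcont : ContinuousOn h (Icc a b) := fun τ hτ => (hd τ hτ).continuousAt.continuousWithinAt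
  have hint : IntervalIntegrable (fun τ => (h' τ / h τ).im) MeasureTheory.volume a b := by
    apply ContinuousOn.intervalIntegrable
    rw [uIcc_of_le hab]
    exact Complex.continuous_im.comp_continuousOn (hc.div hcont h0)
  rw [intervalIntegral.integral_eq_sub_of_hasDerivAt
    (fun τ hτ => hderiv τ (by rwa [uIcc_of_le hab] at hτ)) hint]
  have hbound : ∀ τ ∈ Icc a b, |(Complex.log (c * h τ)).im| ≤ Real.pi / 2 := by
    intro τ hτ
    rw [Complex.log_im]
    exact Complex.abs_arg_le_pi_div_two_iff.2 (hre τ hτ)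
  have ha := abs_le.1 (hbound a (left_mem_Icc.2 hab))
  have hb := abs_le.1 (hbound b (right_mem_Icc.2 hab))
  rw [abs_le]
  constructor <;> linarith [ha.1, ha.2, hb.1, hb.2]

/-- Along a nowhere vanishing curve, the endpoint is recovered from the increment of the
logarithm. -/
theorem exp_integral_logDeriv {h h' : ℝ → ℂ} {a b : ℝ} (hab : a ≤ b)
    (hd : ∀ τ ∈ Icc a b, HasDerivAt h (h' τ) τ) (hc : ContinuousOn h' (Icc a b))
    (h0 : ∀ τ ∈ Icc a b, h τ ≠ 0) :
    h b = h a * Complex.exp (∫ τ in a..b, h' τ / h τ) := by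
  have hcont : ContinuousOn h (Icc a b) := fun τ hτ => (hd τ hτ).continuousAt.continuousWithinAt
  have hq : ContinuousOn (fun τ => h' τ / h τ) (Icc a b) := hc.div hcont h0
  -- Continuity of h'/h is known on [a, b] only, so the primitive is differentiated from the right.
  have hF : ∀ τ ∈ Ico a b, HasDerivWithinAt (fun s => ∫ r in a..s, h' r / h r) (h' τ / h τ)
      (Ici τ) τ := by
    intro τ hτ
    have hint : IntervalIntegrable (fun τ => h' τ / h τ) MeasureTheory.volume a τ := by
      apply ContinuousOn.intervalIntegrable
      rw [uIcc_of_le hτ.1]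
      exact hq.mono (Icc_subset_Icc_right hτ.2.le)
    have hm : Icc a b ∈ 𝓝[>] τ := mem_of_superset (Ioo_mem_nhdsGT hτ.2)
      (Ioo_subset_Icc_self.trans (Icc_subset_Icc_left hτ.1))
    have hcw : ContinuousWithinAt (fun τ => h' τ / h τ) (Ioi τ) τ :=
      (hq τ ⟨hτ.1, hτ.2.le⟩).mono_of_mem_nhdsWithin hm
    refine intervalIntegral.integral_hasDerivWithinAt_right hint ?_ hcw
    exact hq.stronglyMeasurableAtFilter_nhdsWithin measurableSet_Icc τ |>.filter_mono
      (nhdsWithin_le_iff.2 hm)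
  have hFc : ContinuousOn (fun s => ∫ r in a..s, h' r / h r) (Icc a b) := by
    have := intervalIntegral.continuousOn_primitive_interval (μ := MeasureTheory.volume)
      (f := fun τ => h' τ / h τ) (a := a) (b := b)
      (by rw [uIcc_of_le hab]; exact hq.integrableOn_Icc)
    rwa [uIcc_of_le hab] at this
  have key := constant_of_has_deriv_right_zero
    (f := fun s => h s * Complex.exp (-∫ r in a..s, h' r / h r)) (a := a) (b := b)
    (hcont.mul (Complex.continuous_exp.comp_continuousOn hFc.neg)) (by
      intro τ hτ
      have h1 := (hd τ ⟨hτ.1, hτ.2.le⟩).hasDerivWithinAt (s := Ici τ)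
      have h2 := h1.mul (hF τ hτ).neg.cexp
      refine h2.congr_deriv ?_
      have := h0 τ ⟨hτ.1, hτ.2.le⟩
      field_simp
      simp) b (right_mem_Icc.2 hab)
  simp only [intervalIntegral.integral_same, neg_zero, Complex.exp_zero, mul_one] at key
  rw [← key, mul_assoc, ← Complex.exp_add, neg_add_cancel, Complex.exp_zero, mul_one]

/-! ### The argument of the chord of a simple loop. -/

/-- A regular, analytic, `2π`-periodic parametrization of a simple closed curve in `ℂ`. -/
structure IsRegularLoop (z : ℝ → ℂ) : Prop where
  analytic : AnalyticOnNhd ℝ z univ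
  periodic : Function.Periodic z (2 * Real.pi)
  regular : ∀ t, deriv z t ≠ 0
  simple : InjOn z (Ico 0 (2 * Real.pi))

/-- The total increment of the argument of `z τ - z t` as `τ` runs once through the loop. -/
def chordAngle (z : ℝ → ℂ) (t : ℝ) : ℝ :=
  ∫ τ in (t - Real.pi)..(t + Real.pi), (deriv (dslope z t) τ / dslope z t τ).im

theorem sameParam_of_eq {E : Type*} {z : ℝ → E} (hper : Function.Periodic z (2 * Real.pi))
    (hinj : InjOn z (Ico 0 (2 * Real.pi))) {τ t : ℝ} (h : z τ = z t) : SameParam τ t := by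
  have hp := Real.two_pi_pos
  obtain ⟨m, hm, -⟩ := existsUnique_sub_zsmul_mem_Ico hp τ 0
  obtain ⟨n, hn, -⟩ := existsUnique_sub_zsmul_mem_Ico hp t 0
  rw [zero_add] at hm hn
  have h1 : z (τ - m • (2 * Real.pi)) = z (t - n • (2 * Real.pi)) := by
    rw [hper.sub_zsmul_eq, hper.sub_zsmul_eq, h]
  have h2 := hinj hm hn h1
  refine ⟨m - n, ?_⟩
  simp only [zsmul_eq_mul] at h2
  push_cast
  linarith

theorem SameParam.eq_of_abs_lt {τ t : ℝ} (h : SameParam τ t) (hlt : |τ - t| < 2 * Real.pi) :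
    τ = t := by
  obtain ⟨k, hk⟩ := h
  have hp := Real.two_pi_pos
  have h1 : |(k : ℝ)| < 1 := by
    rw [hk, add_sub_cancel_left, abs_mul, abs_of_pos hp] at hlt
    by_contra hcon
    push Not at hcon
    nlinarith
  have h2 : k = 0 := by
    have : |k| < 1 := by exact_mod_cast h1
    exact Int.abs_lt_one_iff.1 this
  simp [hk, h2]

namespace IsRegularLoop

variable {z : ℝ → ℂ}

/-- Off the base point this is simplicity of the curve; at the base point it is regularity. -/
theorem dslope_ne_zero (hz : IsRegularLoop z) {τ t : ℝ} (h : |τ - t| < 2 * Real.pi) :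
    dslope z t τ ≠ 0 := by
  rcases eq_or_ne τ t with rfl | hne
  · rw [dslope_same]
    exact hz.regular τ
  · intro h0
    have h1 := sub_smul_dslope z t τ
    rw [h0, smul_zero] at h1
    exact hne ((sameParam_of_eq hz.periodic hz.simple (sub_eq_zero.1 h1.symm)).eq_of_abs_lt h)

theorem dslope_ne_zero_of_mem (hz : IsRegularLoop z) {τ t : ℝ}
    (h : τ ∈ Icc (t - Real.pi) (t + Real.pi)) : dslope z t τ ≠ 0 := by
  apply hz.dslope_ne_zero
  have := Real.pi_pos
  rw [abs_lt]
  constructor <;> linarith [h.1, h.2]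

theorem hasDerivAt_dslope (hz : IsRegularLoop z) (t τ : ℝ) :
    HasDerivAt (dslope z t) (deriv (dslope z t) τ) τ :=
  hasDerivAt_of_analyticOnNhd (analyticOnNhd_dslope hz.analytic t) τ

theorem continuous_dslope (hz : IsRegularLoop z) (t : ℝ) : Continuous (dslope z t) :=
  continuous_iff_continuousAt.2 fun τ => (hz.hasDerivAt_dslope t τ).continuousAt

theorem continuous_deriv_dslope (hz : IsRegularLoop z) (t : ℝ) :
    Continuous (deriv (dslope z t)) :=
  continuous_iff_continuousAt.2 fun τ =>
    ((analyticOnNhd_dslope hz.analytic t).deriv τ (mem_univ τ)).continuousAt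

/-- The chord is the same at both ends of the period, whereas the divisor goes from -π to π. This
sign makes the total turn an odd multiple of π. -/
theorem dslope_add_pi (hz : IsRegularLoop z) (t : ℝ) :
    dslope z t (t + Real.pi) = -dslope z t (t - Real.pi) := by
  have hp := Real.pi_pos
  have h1 := sub_smul_dslope z t (t + Real.pi)
  have h2 := sub_smul_dslope z t (t - Real.pi)
  have h3 : z (t + Real.pi) = z (t - Real.pi) := by
    rw [← hz.periodic (t - Real.pi)]
    congr 1
    ring
  rw [h3, ← h2, add_sub_cancel_left, sub_sub_cancel_left, neg_smul, ← smul_neg] at h1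
  exact smul_right_injective ℂ hp.ne' h1

theorem continuousOn_logDeriv_dslope (hz : IsRegularLoop z) (t : ℝ) :
    ContinuousOn (fun τ => deriv (dslope z t) τ / dslope z t τ)
      (Icc (t - Real.pi) (t + Real.pi)) :=
  (hz.continuous_deriv_dslope t).continuousOn.div (hz.continuous_dslope t).continuousOn
    fun _ hτ => hz.dslope_ne_zero_of_mem hτ

theorem intervalIntegrable_logDeriv_dslope (hz : IsRegularLoop z) (t : ℝ) :
    IntervalIntegrable (fun τ => deriv (dslope z t) τ / dslope z t τ) MeasureTheory.volume
      (t - Real.pi) (t + Real.pi) := by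
  apply ContinuousOn.intervalIntegrable
  rw [uIcc_of_le (by linarith [Real.pi_pos])]
  exact hz.continuousOn_logDeriv_dslope t

/-- The increment of the argument of the chord is an odd multiple of `π`. -/
theorem exists_chordAngle_eq (hz : IsRegularLoop z) (t : ℝ) :
    ∃ n : ℤ, chordAngle z t = Real.pi + n * (2 * Real.pi) := by
  have hp := Real.pi_pos
  have hle : t - Real.pi ≤ t + Real.pi := by linarith
  have h1 := exp_integral_logDeriv hle (fun τ _ => hz.hasDerivAt_dslope t τ)
    (hz.continuous_deriv_dslope t).continuousOn (fun τ hτ => hz.dslope_ne_zero_of_mem hτ)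
  have h0 := hz.dslope_ne_zero_of_mem (t := t) (left_mem_Icc.2 hle)
  have him : (∫ τ in (t - Real.pi)..(t + Real.pi), deriv (dslope z t) τ / dslope z t τ).im
      = chordAngle z t :=
    (Complex.imCLM.intervalIntegral_comp_comm (hz.intervalIntegrable_logDeriv_dslope t)).symm
  rw [hz.dslope_add_pi, ← mul_neg_one, mul_right_inj' h0, ← Complex.exp_pi_mul_I,
    Complex.exp_eq_exp_iff_exists_int] at h1
  obtain ⟨n, hn⟩ := h1
  refine ⟨-n, ?_⟩
  have h2 := congrArg Complex.im hn
  simp only [Complex.add_im, Complex.mul_im, him] at h2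
  simp at h2
  push_cast
  linarith

theorem chordAngle_eq_add (hz : IsRegularLoop z) (t : ℝ) :
    chordAngle z t = (∫ τ in (t - Real.pi)..t, (deriv (dslope z t) τ / dslope z t τ).im)
      + ∫ τ in t..(t + Real.pi), (deriv (dslope z t) τ / dslope z t τ).im := by
  have hp := Real.pi_pos
  have hc := Complex.continuous_im.comp_continuousOn (hz.continuousOn_logDeriv_dslope t)
  refine (intervalIntegral.integral_add_adjacent_intervals ?_ ?_).symm
  all_goals
    apply ContinuousOn.intervalIntegrable
    rw [uIcc_of_le (by linarith)]
    refine hc.mono (Icc_subset_Icc ?_ ?_) <;> linarith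

/-- At a lowest point of the curve the increment of the argument of the chord is at most `2π`. -/
theorem exists_abs_chordAngle_le (hz : IsRegularLoop z) :
    ∃ t, |chordAngle z t| ≤ 2 * Real.pi := by
  have hp := Real.pi_pos
  have hcz : Continuous fun τ => (z τ).im := Complex.continuous_im.comp
    (continuous_iff_continuousAt.2 fun τ => (hz.analytic τ (mem_univ τ)).continuousAt)
  obtain ⟨t, -, ht⟩ := isCompact_Icc.exists_isMinOn
    (nonempty_Icc.2 Real.two_pi_pos.le) hcz.continuousOn
  have hmin : ∀ τ, (z t).im ≤ (z τ).im := by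
    intro τ
    obtain ⟨s, hs, hzs⟩ := hz.periodic.exists_mem_Ico₀ Real.two_pi_pos τ
    rw [hzs]
    exact ht ⟨hs.1, hs.2.le⟩
  -- Every chord from the lowest point has nonnegative height, so Im D has the sign of τ - t. Each
  -- half of the period therefore keeps D in a closed half-plane and contributes at most π; the
  -- factors -i and i below rotate these half-planes to the right one.
  have hdir : ∀ τ, 0 ≤ (τ - t) * (dslope z t τ).im := by
    intro τ
    have h1 := congrArg Complex.im (sub_smul_dslope z t τ)
    rw [Complex.smul_im, Complex.sub_im, smul_eq_mul] at h1
    rw [h1]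
    linarith [hmin τ]
  have hzero : (dslope z t t).im = 0 := by
    have h1 : IsLocalMin (fun τ => (z τ).im) t := Eventually.of_forall hmin
    have h2 : HasDerivAt (fun τ => (z τ).im) ((deriv z t).im) t :=
      Complex.imCLM.hasFDerivAt.comp_hasDerivAt t (hasDerivAt_of_analyticOnNhd hz.analytic t)
    rw [dslope_same]
    exact h1.hasDerivAt_eq_zero h2
  refine ⟨t, ?_⟩
  rw [hz.chordAngle_eq_add]
  have h1 := abs_integral_im_logDeriv_le (a := t) (b := t + Real.pi) (by linarith)
    (fun τ _ => hz.hasDerivAt_dslope t τ) (hz.continuous_deriv_dslope t).continuousOn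
    (fun τ hτ => hz.dslope_ne_zero_of_mem ⟨by linarith [hτ.1], hτ.2⟩) (-Complex.I) (by simp) (by
      intro τ hτ
      have h3 : (-Complex.I * dslope z t τ).re = (dslope z t τ).im := by simp
      rw [h3]
      rcases hτ.1.eq_or_lt with rfl | hlt
      · exact hzero.ge
      · exact nonneg_of_mul_nonneg_right (hdir τ) (sub_pos.2 hlt))
  have h2 := abs_integral_im_logDeriv_le (a := t - Real.pi) (b := t) (by linarith)
    (fun τ _ => hz.hasDerivAt_dslope t τ) (hz.continuous_deriv_dslope t).continuousOn
    (fun τ hτ => hz.dslope_ne_zero_of_mem ⟨hτ.1, by linarith [hτ.2]⟩) Complex.I (by simp) (by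
      intro τ hτ
      have h3 : (Complex.I * dslope z t τ).re = -(dslope z t τ).im := by simp
      rw [h3]
      rcases hτ.2.eq_or_lt with rfl | hlt
      · rw [hzero, neg_zero]
      · have := hdir τ
        nlinarith)
  exact (abs_add_le _ _).trans (by linarith)

/-- The increments of the arguments of `z τ - p` and of `z τ - z t`, where `z t` is a point of the
curve next to `p`, differ by at most `2π`. -/
theorem exists_abs_winding_sub_chordAngle_le (hz : IsRegularLoop z) {p : ℂ} (hp : p ∉ range z) :
    ∃ t, |(∫ τ in (0 : ℝ)..(2 * Real.pi), (deriv z τ / (z τ - p)).im) - chordAngle z t|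
      ≤ 2 * Real.pi := by
  have hpi := Real.pi_pos
  have hcz : Continuous z :=
    continuous_iff_continuousAt.2 fun τ => (hz.analytic τ (mem_univ τ)).continuousAt
  have hcz' : Continuous (deriv z) :=
    continuous_iff_continuousAt.2 fun τ => (hz.analytic.deriv τ (mem_univ τ)).continuousAt
  have hzp : ∀ τ, z τ - p ≠ 0 := fun τ h => hp ⟨τ, sub_eq_zero.1 h⟩
  obtain ⟨t, -, ht⟩ := isCompact_Icc.exists_isMinOn (nonempty_Icc.2 Real.two_pi_pos.le)
    (continuous_norm.comp (hcz.sub continuous_const : Continuous fun τ => z τ - p)).continuousOn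
  have hmin : ∀ τ, ‖z t - p‖ ≤ ‖z τ - p‖ := by
    intro τ
    obtain ⟨s, hs, hzs⟩ := hz.periodic.exists_mem_Ico₀ Real.two_pi_pos τ
    rw [hzs]
    exact ht ⟨hs.1, hs.2.le⟩
  refine ⟨t, ?_⟩
  have hperint : (∫ τ in (0 : ℝ)..(2 * Real.pi), (deriv z τ / (z τ - p)).im)
      = ∫ τ in (t - Real.pi)..(t + Real.pi), (deriv z τ / (z τ - p)).im := by
    have hper : Function.Periodic (fun τ => (deriv z τ / (z τ - p)).im) (2 * Real.pi) := by
      intro τ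
      have h1 : deriv z (τ + 2 * Real.pi) = deriv z τ := by
        rw [← deriv_comp_add_const]
        congr 1
        exact funext hz.periodic
      simp only [h1, hz.periodic τ]
    have := hper.intervalIntegral_add_eq 0 (t - Real.pi)
    rw [zero_add] at this
    rw [this]
    congr 1
    ring
  set D := dslope z t with hD
  have hDd := hz.hasDerivAt_dslope t
  -- The logarithmic derivative of this quotient is z'/(z - p) - D'/D, so the increment of its
  -- argument is the difference to be bounded.
  set h : ℝ → ℂ := fun τ => (z τ - p) / D τ with hh
  set h' : ℝ → ℂ := fun τ => (deriv z τ * D τ - (z τ - p) * deriv D τ) / D τ ^ 2 with hh'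
  have hsub : Icc (t - Real.pi) (t + Real.pi) ⊆ {τ | D τ ≠ 0} := fun τ hτ =>
    hz.dslope_ne_zero_of_mem hτ
  have hderiv : ∀ τ ∈ Icc (t - Real.pi) (t + Real.pi), HasDerivAt h (h' τ) τ := fun τ hτ =>
    ((hasDerivAt_of_analyticOnNhd hz.analytic τ).sub_const p).div (hDd τ) (hsub hτ)
  have hcont : ContinuousOn h' (Icc (t - Real.pi) (t + Real.pi)) := by
    refine ContinuousOn.div ?_ ((hz.continuous_dslope t).pow 2).continuousOn
      fun τ hτ => pow_ne_zero 2 (hsub hτ)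
    exact ((hcz'.mul (hz.continuous_dslope t)).sub
      ((hcz.sub continuous_const).mul (hz.continuous_deriv_dslope t))).continuousOn
  have hne : ∀ τ ∈ Icc (t - Real.pi) (t + Real.pi), h τ ≠ 0 := fun τ hτ =>
    div_ne_zero (hzp τ) (hsub hτ)
  have hlog : ∀ τ ∈ Icc (t - Real.pi) (t + Real.pi),
      (h' τ / h τ).im = (deriv z τ / (z τ - p)).im - (deriv D τ / D τ).im := by
    intro τ hτ
    have h1 : D τ ≠ 0 := hsub hτ
    have h2 := hzp τ
    rw [← Complex.sub_im]
    congr 1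
    simp only [hh, hh']
    field_simp
  -- the real part of `h` has the sign of `τ - t`
  have hre : ∀ τ ∈ Icc (t - Real.pi) (t + Real.pi), τ ≠ t → 0 ≤ (τ - t) * (h τ).re := by
    intro τ hτ hτt
    have h1 : D τ ≠ 0 := hsub hτ
    have h2 : z τ = z t + (τ - t) * D τ := by
      have := sub_smul_dslope z t τ
      rw [Complex.real_smul] at this
      push_cast at this
      rw [hD, this]
      ring
    -- With s = τ - t and z - p = (z(t) - p) + s D, minimality of |z(t) - p| reads 2s Re((z(t) - p)
    -- D̄) + s²|D|² ≥ 0. Hence s Re((z - p) D̄) ≥ s²|D|²/2 ≥ 0.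
    have h3 := pow_le_pow_left₀ (norm_nonneg _) (hmin τ) 2
    rw [← Complex.normSq_eq_norm_sq, ← Complex.normSq_eq_norm_sq, h2] at h3
    have h4 : 0 < Complex.normSq (D τ) := Complex.normSq_pos.2 h1
    have h5 : (h τ).re = ((z τ - p).re * (D τ).re + (z τ - p).im * (D τ).im)
        / Complex.normSq (D τ) := by
      simp only [hh, Complex.div_re]
      ring
    rw [h5, ← mul_div_assoc]
    refine div_nonneg ?_ h4.le
    rw [h2]
    simp only [Complex.normSq_apply, Complex.add_re, Complex.add_im, Complex.sub_re,
      Complex.sub_im, Complex.mul_re, Complex.mul_im, Complex.ofReal_re, Complex.ofReal_im] at h3 ⊢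
    nlinarith [mul_self_nonneg ((τ - t) * (D τ).re), mul_self_nonneg ((τ - t) * (D τ).im)]
  have hmid : t ∈ Icc (t - Real.pi) (t + Real.pi) := ⟨by linarith, by linarith⟩
  have hzero : (h t).re = 0 := by
    have hc : ContinuousAt (fun τ => (h τ).re) t :=
      Complex.continuous_re.continuousAt.comp (hderiv t hmid).continuousAt
    apply le_antisymm
    · refine le_of_tendsto (hc.tendsto.mono_left (nhdsWithin_le_nhds (s := Iio t))) ?_
      filter_upwards [Ioo_mem_nhdsLT (show t - Real.pi < t by linarith)] with τ hτ
      have := hre τ ⟨hτ.1.le, by linarith [hτ.2]⟩ hτ.2.ne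
      nlinarith [hτ.2]
    · refine ge_of_tendsto (hc.tendsto.mono_left (nhdsWithin_le_nhds (s := Ioi t))) ?_
      filter_upwards [Ioo_mem_nhdsGT (show t < t + Real.pi by linarith)] with τ hτ
      have := hre τ ⟨by linarith [hτ.1], hτ.2.le⟩ hτ.1.ne'
      nlinarith [hτ.1]
  have hsub1 : Icc t (t + Real.pi) ⊆ Icc (t - Real.pi) (t + Real.pi) :=
    Icc_subset_Icc_left (by linarith)
  have hsub2 : Icc (t - Real.pi) t ⊆ Icc (t - Real.pi) (t + Real.pi) :=
    Icc_subset_Icc_right (by linarith)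
  have hhc : ContinuousOn (fun τ => (h' τ / h τ).im) (Icc (t - Real.pi) (t + Real.pi)) :=
    Complex.continuous_im.comp_continuousOn
      (hcont.div (fun τ hτ => (hderiv τ hτ).continuousAt.continuousWithinAt) hne)
  have hsplit : (∫ τ in (0 : ℝ)..(2 * Real.pi), (deriv z τ / (z τ - p)).im) - chordAngle z t
      = (∫ τ in (t - Real.pi)..t, (h' τ / h τ).im)
        + ∫ τ in t..(t + Real.pi), (h' τ / h τ).im := by
    rw [hperint, chordAngle, ← intervalIntegral.integral_sub,
      intervalIntegral.integral_add_adjacent_intervals]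
    · refine intervalIntegral.integral_congr fun τ hτ => ?_
      rw [uIcc_of_le (by linarith)] at hτ
      exact (hlog τ hτ).symm
    · apply ContinuousOn.intervalIntegrable
      rw [uIcc_of_le (by linarith)]
      exact hhc.mono hsub2
    · apply ContinuousOn.intervalIntegrable
      rw [uIcc_of_le (by linarith)]
      exact hhc.mono hsub1
    · exact (Complex.continuous_im.comp
        (hcz'.div (hcz.sub continuous_const) hzp)).intervalIntegrable _ _
    · apply ContinuousOn.intervalIntegrable
      rw [uIcc_of_le (by linarith)]
      exact Complex.continuous_im.comp_continuousOn (hz.continuousOn_logDeriv_dslope t)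
  rw [hsplit]
  have h1 := abs_integral_im_logDeriv_le (a := t) (b := t + Real.pi) (by linarith)
    (fun τ hτ => hderiv τ (hsub1 hτ)) (hcont.mono hsub1) (fun τ hτ => hne τ (hsub1 hτ)) 1
    one_ne_zero (by
      intro τ hτ
      rw [one_mul]
      rcases hτ.1.eq_or_lt with rfl | hlt
      · exact hzero.ge
      · exact nonneg_of_mul_nonneg_right (hre τ (hsub1 hτ) hlt.ne') (sub_pos.2 hlt))
  have h2 := abs_integral_im_logDeriv_le (a := t - Real.pi) (b := t) (by linarith)
    (fun τ hτ => hderiv τ (hsub2 hτ)) (hcont.mono hsub2) (fun τ hτ => hne τ (hsub2 hτ)) (-1)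
    (by simp) (by
      intro τ hτ
      rw [neg_one_mul, Complex.neg_re]
      rcases hτ.2.eq_or_lt with rfl | hlt
      · rw [hzero, neg_zero]
      · have := hre τ (hsub2 hτ) hlt.ne
        nlinarith)
  exact (abs_add_le _ _).trans (by linarith)

/-! ### Dependence of the chord angle on the base point. -/

theorem continuous (hz : IsRegularLoop z) : Continuous z :=
  continuous_iff_continuousAt.2 fun τ => (hz.analytic τ (mem_univ τ)).continuousAt

theorem continuous_deriv (hz : IsRegularLoop z) : Continuous (deriv z) :=
  continuous_iff_continuousAt.2 fun τ => (hz.analytic.deriv τ (mem_univ τ)).continuousAt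

theorem continuous_deriv_deriv (hz : IsRegularLoop z) : Continuous (deriv (deriv z)) :=
  continuous_iff_continuousAt.2 fun τ => (hz.analytic.deriv.deriv τ (mem_univ τ)).continuousAt

/-- The integral form shows joint continuity in base point and increment, diagonal included. -/
theorem dslope_eq_integral (hz : IsRegularLoop z) (t s : ℝ) :
    dslope z t (t + s) = ∫ r in (0 : ℝ)..1, deriv z (t + r * s) := by
  rcases eq_or_ne s 0 with rfl | hs
  · simp [dslope_same]
  · have hd : ∀ r ∈ uIcc (0 : ℝ) 1,
        HasDerivAt (fun r : ℝ => z (t + r * s)) (s • deriv z (t + r * s)) r := by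
      intro r _
      have h1 : HasDerivAt (fun r : ℝ => t + r * s) s r := by
        simpa using ((hasDerivAt_id r).mul_const s).const_add t
      exact (hasDerivAt_of_analyticOnNhd hz.analytic (t + r * s)).scomp r h1
    have hc : Continuous fun r : ℝ => s • deriv z (t + r * s) := by
      have := hz.continuous_deriv
      fun_prop
    have h2 := intervalIntegral.integral_eq_sub_of_hasDerivAt hd (hc.intervalIntegrable _ _)
    rw [intervalIntegral.integral_smul] at h2
    have h3 := sub_smul_dslope z t (t + s)
    rw [add_sub_cancel_left] at h3
    apply smul_right_injective ℂ hs
    simp only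
    rw [h3, h2]
    simp

/-- For s ≠ 0, integrate the r-derivative of r z'(t + r s) over [0, 1] and compare with z' = D + s
D'. -/
theorem deriv_dslope_eq_integral (hz : IsRegularLoop z) (t s : ℝ) :
    deriv (dslope z t) (t + s) = ∫ r in (0 : ℝ)..1, r • deriv (deriv z) (t + r * s) := by
  rcases eq_or_ne s 0 with rfl | hs
  · have h1 := deriv_deriv_eq_two_smul_deriv_dslope hz.analytic t
    simp only [mul_zero, add_zero]
    rw [intervalIntegral.integral_smul_const, h1, integral_id, smul_smul]
    norm_num
  · have hd : ∀ r ∈ uIcc (0 : ℝ) 1,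
        HasDerivAt (fun r : ℝ => r • deriv z (t + r * s))
          (r • (s • deriv (deriv z) (t + r * s)) + (1 : ℝ) • deriv z (t + r * s)) r := by
      intro r _
      have h1 : HasDerivAt (fun r : ℝ => t + r * s) s r := by
        simpa using ((hasDerivAt_id r).mul_const s).const_add t
      have h2 : HasDerivAt (fun r : ℝ => deriv z (t + r * s)) (s • deriv (deriv z) (t + r * s)) r :=
        HasDerivAt.scomp (g₁ := deriv z) r
          (hasDerivAt_of_analyticOnNhd hz.analytic.deriv (t + r * s)) h1
      exact (hasDerivAt_id r).smul h2
    have hc1 : Continuous fun r : ℝ => r • (s • deriv (deriv z) (t + r * s)) := by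
      have := hz.continuous_deriv_deriv
      fun_prop
    have hc2 : Continuous fun r : ℝ => (1 : ℝ) • deriv z (t + r * s) := by
      have := hz.continuous_deriv
      fun_prop
    have h2 := intervalIntegral.integral_eq_sub_of_hasDerivAt hd
      ((hc1.add hc2).intervalIntegrable _ _)
    rw [intervalIntegral.integral_add (hc1.intervalIntegrable _ _) (hc2.intervalIntegrable _ _)]
      at h2
    simp only [one_smul, zero_smul, sub_zero, one_mul] at h2
    rw [← hz.dslope_eq_integral, deriv_eq_dslope_add hz.analytic t (t + s), add_sub_cancel_left,
      add_comm, add_right_inj] at h2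
    apply smul_right_injective ℂ hs
    simp only
    rw [← h2, ← intervalIntegral.integral_smul]
    simp only [smul_comm s]

theorem continuous_chordAngle (hz : IsRegularLoop z) : Continuous (chordAngle z) := by
  have hpi := Real.pi_pos
  set D : ℝ → ℝ → ℂ := fun t s => ∫ r in (0 : ℝ)..1, deriv z (t + r * s) with hD
  set E : ℝ → ℝ → ℂ := fun t s => ∫ r in (0 : ℝ)..1, r • deriv (deriv z) (t + r * s) with hE
  have hDc : Continuous fun q : ℝ × ℝ => D q.1 q.2 := by
    have := hz.continuous_deriv
    exact intervalIntegral.continuous_parametric_intervalIntegral_of_continuous'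
      (by fun_prop) 0 1
  have hEc : Continuous fun q : ℝ × ℝ => E q.1 q.2 := by
    have := hz.continuous_deriv_deriv
    exact intervalIntegral.continuous_parametric_intervalIntegral_of_continuous'
      (by fun_prop) 0 1
  -- The increment s is clamped to [-π, π], which changes nothing on the domain of integration but
  -- keeps the integrand continuous on all of ℝ × ℝ: the denominator D vanishes at s = ±2π.
  have hangle : chordAngle z = fun t => ∫ s in (-Real.pi)..Real.pi,
      (E t (max (-Real.pi) (min Real.pi s)) / D t (max (-Real.pi) (min Real.pi s))).im := by
    funext t
    have h1 := intervalIntegral.integral_comp_add_left (a := -Real.pi) (b := Real.pi)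
      (fun τ => (deriv (dslope z t) τ / dslope z t τ).im) t
    rw [chordAngle, sub_eq_add_neg, ← h1]
    refine intervalIntegral.integral_congr fun s hs => ?_
    rw [uIcc_of_le (by linarith)] at hs
    rw [min_eq_right hs.2, max_eq_right hs.1, hz.deriv_dslope_eq_integral,
      hz.dslope_eq_integral]
  rw [hangle]
  refine intervalIntegral.continuous_parametric_intervalIntegral_of_continuous'
    (f := fun t s => (E t (max (-Real.pi) (min Real.pi s))
      / D t (max (-Real.pi) (min Real.pi s))).im) ?_ _ _
  have hcl : Continuous fun q : ℝ × ℝ => (q.1, max (-Real.pi) (min Real.pi q.2)) := by fun_prop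
  refine Complex.continuous_im.comp ((hEc.comp hcl).div (hDc.comp hcl) ?_)
  intro q
  simp only [hD]
  rw [← hz.dslope_eq_integral]
  apply hz.dslope_ne_zero_of_mem
  constructor
  · linarith [le_max_left (-Real.pi) (min Real.pi q.2)]
  · have : max (-Real.pi) (min Real.pi q.2) ≤ Real.pi := max_le (by linarith) (min_le_left _ _)
    linarith

/-- For a simple loop that winds once around some point, the increment of the argument of the chord
from any point of the curve is `π`. -/
theorem chordAngle_eq_pi (hz : IsRegularLoop z) {p : ℂ} (hp : p ∉ range z)
    (hw : ∫ τ in (0 : ℝ)..(2 * Real.pi), (deriv z τ / (z τ - p)).im = 2 * Real.pi) (t : ℝ) :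
    chordAngle z t = Real.pi := by
  have hpi := Real.pi_pos
  choose n hn using hz.exists_chordAngle_eq
  have hncont : Continuous n := by
    have h1 : Continuous fun t => (n t : ℝ) := by
      have h2 : (fun t => (n t : ℝ)) = fun t => (chordAngle z t - Real.pi) / (2 * Real.pi) := by
        funext t
        rw [hn t]
        field_simp
        ring
      rw [h2]
      exact (hz.continuous_chordAngle.sub continuous_const).div_const _
    exact Int.isClosedEmbedding_coe_real.isInducing.continuous_iff.2 h1
  have hconst : ∀ a b, n a = n b := fun a b =>
    PreconnectedSpace.constant inferInstance hncont
  obtain ⟨a, ha⟩ := hz.exists_abs_chordAngle_le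
  obtain ⟨b, hb⟩ := hz.exists_abs_winding_sub_chordAngle_le hp
  rw [hn a, abs_le] at ha
  rw [hw, hn b, abs_le] at hb
  rw [hconst b a] at hb
  -- For the angle π + 2πn, the lowest point gives -3/2 ≤ n ≤ 1/2 and the nearest point gives -1/2 ≤
  -- n ≤ 3/2.
  have h1 : (n a : ℝ) < 1 := by nlinarith
  have h2 : (-1 : ℝ) < n a := by nlinarith
  have h3 : n a = 0 := by
    have h4 : n a < 1 := by exact_mod_cast h1
    have h5 : -1 < n a := by exact_mod_cast h2
    omega
  rw [hn t, hconst t a, h3]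
  simp

end IsRegularLoop

/-! ### Cutting the curve at distance ε, and finite parts. -/

/-- The inverse function theorem supplies the section g, and near t all difference quotients exceed
c/2 because the derivative is strict. Applied to the signed distance, g finds the two points at
distance ε and monotonicity turns distance inequalities into order. -/
theorem exists_section_of_hasStrictDerivAt {σ : ℝ → ℝ} {c t : ℝ} (hσ : HasStrictDerivAt σ c t)
    (hc : 0 < c) :
    ∃ g : ℝ → ℝ, Tendsto g (𝓝 (σ t)) (𝓝 t) ∧ (∀ᶠ y in 𝓝 (σ t), σ (g y) = y) ∧
      ∃ η > 0, StrictMonoOn σ (Ioo (t - η) (t + η)) := by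
  have hσ' := hσ.hasStrictFDerivAt_equiv hc.ne'
  refine ⟨hσ'.localInverse σ _ t, hσ'.localInverse_tendsto, hσ'.eventually_right_inverse, ?_⟩
  obtain ⟨s, hs, happ⟩ := hσ.hasStrictFDerivAt.approximates_deriv_on_nhds
    (c := ⟨c / 2, (half_pos hc).le⟩) (Or.inr (half_pos hc))
  obtain ⟨η, hη, hsub⟩ := Metric.mem_nhds_iff.1 hs
  rw [Real.ball_eq_Ioo] at hsub
  refine ⟨η, hη, fun x hx y hy hxy => ?_⟩
  have h1 := happ y (hsub hy) x (hsub hx)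
  change _ ≤ c / 2 * _ at h1
  rw [Real.norm_eq_abs, Real.norm_eq_abs, abs_of_pos (sub_pos.2 hxy), abs_le] at h1
  have h3 := h1.1
  simp only [ContinuousLinearMap.toSpanSingleton_apply, smul_eq_mul] at h3
  nlinarith

namespace IsRegularLoop

variable {z : ℝ → ℂ}

/-- The distance to z(t) has a corner at t; giving it the sign of τ - t makes it smooth there with
positive slope. -/
theorem hasStrictDerivAt_signedDist (hz : IsRegularLoop z) (t : ℝ) :
    HasStrictDerivAt (fun τ => (τ - t) * ‖dslope z t τ‖) ‖deriv z t‖ t := by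
  have hD : ContDiffAt ℝ 1 (fun τ => ‖dslope z t τ‖) t :=
    ((analyticOnNhd_dslope hz.analytic t t (mem_univ t)).contDiffAt).norm ℝ
      (by rw [dslope_same]; exact hz.regular t)
  have hsub : HasStrictDerivAt (fun τ : ℝ => τ - t) 1 t := (hasStrictDerivAt_id t).sub_const t
  have h1 := hsub.mul (hD.hasStrictDerivAt one_ne_zero)
  refine h1.congr_deriv ?_
  simp

theorem abs_signedDist (t τ : ℝ) : |(τ - t) * ‖dslope z t τ‖| = ‖z t - z τ‖ := by
  rw [norm_sub_rev, ← sub_smul_dslope, norm_smul, abs_mul, abs_norm, Real.norm_eq_abs]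

/-- The part of the curve near `z t` is an arc whose endpoints, at distance `ε` from `z t`, tend
to `z t` as `ε → 0`. -/
theorem exists_arc_endpoints (hz : IsRegularLoop z) (t : ℝ) :
    ∃ a b : ℝ → ℝ, Tendsto a (𝓝[>] 0) (𝓝[<] t) ∧ Tendsto b (𝓝[>] 0) (𝓝[>] t) ∧
      ∀ᶠ ε in 𝓝[>] (0 : ℝ), (a ε - t) * ‖dslope z t (a ε)‖ = -ε ∧
        (b ε - t) * ‖dslope z t (b ε)‖ = ε ∧
        ∀ τ ∈ Icc (t - Real.pi) (t + Real.pi), ε < ‖z t - z τ‖ ↔ τ < a ε ∨ b ε < τ := by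
  have hpi := Real.pi_pos
  set σ : ℝ → ℝ := fun τ => (τ - t) * ‖dslope z t τ‖ with hσ
  have hσt : σ t = 0 := by simp [hσ]
  obtain ⟨g, hg, hinv, η, hη, hmono⟩ := exists_section_of_hasStrictDerivAt
    (hz.hasStrictDerivAt_signedDist t) (norm_pos_iff.2 (hz.regular t))
  change Tendsto g (𝓝 (σ t)) (𝓝 t) at hg
  change ∀ᶠ y in 𝓝 (σ t), σ (g y) = y at hinv
  rw [hσt] at hg hinv
  have hpos : Tendsto (fun ε : ℝ => ε) (𝓝[>] 0) (𝓝 0) := nhdsWithin_le_nhds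
  have hneg : Tendsto (fun ε : ℝ => -ε) (𝓝[>] 0) (𝓝 0) := by simpa using hpos.neg
  have hIoo : Ioo (t - η) (t + η) ∈ 𝓝 t := Ioo_mem_nhds (by linarith) (by linarith)
  have hIlt : ∀ τ, 0 < σ τ → t < τ := fun τ h => by
    by_contra hcon
    push Not at hcon
    have : σ τ ≤ 0 := mul_nonpos_of_nonpos_of_nonneg (by linarith) (norm_nonneg _)
    linarith
  have hIgt : ∀ τ, σ τ < 0 → τ < t := fun τ h => by
    by_contra hcon
    push Not at hcon
    have : 0 ≤ σ τ := mul_nonneg (by linarith) (norm_nonneg _)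
    linarith
  have ha : Tendsto (fun ε => g (-ε)) (𝓝[>] 0) (𝓝[<] t) := by
    refine tendsto_nhdsWithin_iff.2 ⟨hg.comp hneg, ?_⟩
    filter_upwards [hneg.eventually hinv, self_mem_nhdsWithin] with ε h1 h2
    exact hIgt _ (by rw [h1]; simpa using h2)
  have hb : Tendsto g (𝓝[>] 0) (𝓝[>] t) := by
    refine tendsto_nhdsWithin_iff.2 ⟨hg.comp hpos, ?_⟩
    filter_upwards [hpos.eventually hinv, self_mem_nhdsWithin] with ε h1 h2
    exact hIlt _ (by rw [h1]; exact h2)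
  -- away from `t` the distance is bounded below
  obtain ⟨c, hc, hcle⟩ : ∃ c > 0, ∀ τ ∈ Icc (t - Real.pi) (t + Real.pi) \ Ioo (t - η) (t + η),
      c ≤ ‖z t - z τ‖ := by
    have hK : IsCompact (Icc (t - Real.pi) (t + Real.pi) \ Ioo (t - η) (t + η)) :=
      isCompact_Icc.diff isOpen_Ioo
    rcases (Icc (t - Real.pi) (t + Real.pi) \ Ioo (t - η) (t + η)).eq_empty_or_nonempty with he | hne
    · exact ⟨1, one_pos, fun τ hτ => by rw [he] at hτ; exact hτ.elim⟩
    · obtain ⟨τ₀, hτ₀, hmin⟩ := hK.exists_isMinOn hne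
        (continuous_norm.comp (continuous_const.sub hz.continuous :
          Continuous fun τ => z t - z τ)).continuousOn
      refine ⟨‖z t - z τ₀‖, ?_, fun τ hτ => hmin hτ⟩
      rw [← abs_signedDist]
      refine abs_pos.2 (mul_ne_zero ?_ (norm_ne_zero_iff.2 (hz.dslope_ne_zero_of_mem hτ₀.1)))
      intro h0
      apply hτ₀.2
      rw [sub_eq_zero.1 h0]
      exact ⟨by linarith, by linarith⟩
  refine ⟨fun ε => g (-ε), g, ha, hb, ?_⟩
  filter_upwards [hpos.eventually hinv, hneg.eventually hinv, (hg.comp hpos).eventually hIoo,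
    (hg.comp hneg).eventually hIoo, hpos.eventually (Iio_mem_nhds hc), self_mem_nhdsWithin]
    with ε h1 h2 h3 h4 h5 h6
  change 0 < ε at h6
  refine ⟨h2, h1, fun τ hτ => ?_⟩
  have h3' : g ε ∈ Ioo (t - η) (t + η) := h3
  have h4' : g (-ε) ∈ Ioo (t - η) (t + η) := h4
  by_cases hmem : τ ∈ Ioo (t - η) (t + η)
  · rw [← abs_signedDist, lt_abs, or_comm, ← hmono.lt_iff_lt hmem h4',
      ← hmono.lt_iff_lt h3' hmem]
    change _ ↔ σ τ < σ (g (-ε)) ∨ σ (g ε) < σ τ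
    rw [h1, h2]
    change ε < -σ τ ∨ ε < σ τ ↔ _
    rw [lt_neg]
  · refine iff_of_true (lt_of_lt_of_le h5 (hcle τ ⟨hτ, hmem⟩)) ?_
    rw [mem_Ioo, not_and_or, not_lt, not_lt] at hmem
    rcases hmem with h | h
    · exact Or.inl (h.trans_lt h4'.1)
    · exact Or.inr (h3'.2.trans_le h)

/-- The truncated integral of a periodic function, as a sum of integrals over two intervals. -/
theorem setIntegral_truncated_eq (hz : IsRegularLoop z) {t ε a b : ℝ} {k : ℝ → ℝ}
    (hk : Function.Periodic k (2 * Real.pi)) (ha : a ∈ Icc (t - Real.pi) t)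
    (hb : b ∈ Icc t (t + Real.pi))
    (hab : ∀ τ ∈ Icc (t - Real.pi) (t + Real.pi), ε < ‖z t - z τ‖ ↔ τ < a ∨ b < τ)
    (hka : IntervalIntegrable k MeasureTheory.volume (t - Real.pi) a)
    (hkb : IntervalIntegrable k MeasureTheory.volume b (t + Real.pi)) :
    ∫ τ in {τ | τ ∈ Ico 0 (2 * Real.pi) ∧ ε < ‖z t - z τ‖}, k τ
      = (∫ τ in (t - Real.pi)..a, k τ) + ∫ τ in b..(t + Real.pi), k τ := by
  have hpi := Real.pi_pos
  set S : Set ℝ := {τ | ε < ‖z t - z τ‖} with hS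
  have hSm : MeasurableSet S :=
    (isOpen_lt continuous_const (continuous_norm.comp (continuous_const.sub hz.continuous))
      ).measurableSet
  -- Putting the truncation into the integrand keeps it periodic, so the period can be recentred at
  -- t.
  have hper : Function.Periodic (S.indicator k) (2 * Real.pi) := by
    intro τ
    simp only [indicator, hS, mem_ofPred_eq, hz.periodic τ, hk τ]
  have h1 : ∫ τ in {τ | τ ∈ Ico 0 (2 * Real.pi) ∧ ε < ‖z t - z τ‖}, k τ
      = ∫ τ in (0 : ℝ)..(2 * Real.pi), S.indicator k τ := by
    rw [intervalIntegral.integral_of_le Real.two_pi_pos.le,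
      MeasureTheory.integral_Ioc_eq_integral_Ioo, ← MeasureTheory.integral_Ico_eq_integral_Ioo,
      MeasureTheory.setIntegral_indicator hSm]
    rfl
  have h2 : ∫ τ in (0 : ℝ)..(2 * Real.pi), S.indicator k τ
      = ∫ τ in (t - Real.pi)..(t + Real.pi), S.indicator k τ := by
    have := hper.intervalIntegral_add_eq 0 (t - Real.pi)
    rw [zero_add] at this
    rw [this]
    congr 1
    ring
  have h3 : Ioc (t - Real.pi) (t + Real.pi) ∩ S = Ioo (t - Real.pi) a ∪ Ioc b (t + Real.pi) := by
    ext τ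
    simp only [mem_inter_iff, mem_Ioc, mem_union, mem_Ioo]
    constructor
    · rintro ⟨⟨h4, h5⟩, h6⟩
      rcases (hab τ ⟨h4.le, h5⟩).1 h6 with h7 | h7
      · exact Or.inl ⟨h4, h7⟩
      · exact Or.inr ⟨h7, h5⟩
    · rintro (⟨h4, h5⟩ | ⟨h4, h5⟩)
      · have h6 : τ ≤ t + Real.pi := by linarith [ha.2]
        exact ⟨⟨h4, h6⟩, (hab τ ⟨h4.le, h6⟩).2 (Or.inl h5)⟩
      · have h6 : t - Real.pi < τ := by linarith [hb.1]
        exact ⟨⟨h6, h5⟩, (hab τ ⟨h6.le, h5⟩).2 (Or.inr h4)⟩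
  rw [h1, h2, intervalIntegral.integral_of_le (by linarith),
    MeasureTheory.setIntegral_indicator hSm, h3, MeasureTheory.setIntegral_union,
    ← MeasureTheory.integral_Ioc_eq_integral_Ioo, intervalIntegral.integral_of_le ha.1,
    intervalIntegral.integral_of_le hb.2]
  · rw [disjoint_left]
    intro τ h4 h5
    linarith [h4.2, h5.1, ha.2, hb.1]
  · exact measurableSet_Ioc
  · rw [intervalIntegrable_iff_integrableOn_Ioc_of_le ha.1] at hka
    exact hka.mono_set Ioo_subset_Ioc_self
  · rwa [intervalIntegrable_iff_integrableOn_Ioc_of_le hb.2] at hkb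

/-- The finite part of the integral of `A' + r`, where `r` is regular and the singularity of `A` is
that of an odd function of order `-1`, up to a logarithm, in the signed distance from `z t`. -/
theorem hasFinitePart_of_primitive (hz : IsRegularLoop z) {t : ℝ} {k A A' r : ℝ → ℝ} {α β L : ℝ}
    (hk : Function.Periodic k (2 * Real.pi))
    (hr : ContinuousOn r (Icc (t - Real.pi) (t + Real.pi)))
    (hA : ∀ τ ∈ Icc (t - Real.pi) (t + Real.pi), τ ≠ t → HasDerivAt A (A' τ) τ)
    (hA' : ContinuousOn A' (Icc (t - Real.pi) (t + Real.pi) \ {t}))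
    (hper : A (t - Real.pi) = A (t + Real.pi))
    (hkA : ∀ τ ∈ Icc (t - Real.pi) (t + Real.pi), τ ≠ t → k τ = A' τ + r τ)
    (hlim : Tendsto (fun τ => A τ + α / ((τ - t) * ‖dslope z t τ‖)
      + β * Real.log ‖z t - z τ‖) (𝓝[≠] t) (𝓝 L)) :
    HasFinitePart
      (fun ε => ∫ τ in {τ | τ ∈ Ico 0 (2 * Real.pi) ∧ ε < ‖z t - z τ‖}, k τ)
      (∫ τ in (t - Real.pi)..(t + Real.pi), r τ) := by
  have hpi := Real.pi_pos
  obtain ⟨a, b, ha, hb, hab⟩ := hz.exists_arc_endpoints t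
  have hrint : IntervalIntegrable r MeasureTheory.volume (t - Real.pi) (t + Real.pi) := by
    apply ContinuousOn.intervalIntegrable
    rwa [uIcc_of_le (by linarith)]
  have hpiece : ∀ u v, u ≤ v → Icc u v ⊆ Icc (t - Real.pi) (t + Real.pi) \ {t} →
      IntervalIntegrable k MeasureTheory.volume u v ∧
        ∫ τ in u..v, k τ = A v - A u + ∫ τ in u..v, r τ := by
    intro u v huv hsub
    have h1 : IntervalIntegrable A' MeasureTheory.volume u v := by
      apply ContinuousOn.intervalIntegrable
      rw [uIcc_of_le huv]
      exact hA'.mono hsub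
    have h2 : IntervalIntegrable r MeasureTheory.volume u v := by
      apply ContinuousOn.intervalIntegrable
      rw [uIcc_of_le huv]
      exact hr.mono fun τ hτ => (hsub hτ).1
    have h3 : EqOn (fun τ => A' τ + r τ) k (uIcc u v) := by
      intro τ hτ
      rw [uIcc_of_le huv] at hτ
      exact (hkA τ (hsub hτ).1 (hsub hτ).2).symm
    refine ⟨(h1.add h2).congr (h3.mono uIoc_subset_uIcc), ?_⟩
    rw [← intervalIntegral.integral_congr h3, intervalIntegral.integral_add h1 h2,
      intervalIntegral.integral_eq_sub_of_hasDerivAt _ h1]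
    intro τ hτ
    rw [uIcc_of_le huv] at hτ
    exact hA τ (hsub hτ).1 (hsub hτ).2
  set B : ℝ → ℝ := fun τ => A τ + α / ((τ - t) * ‖dslope z t τ‖) + β * Real.log ‖z t - z τ‖
    with hB
  have hne1 : 𝓝[<] t ≤ 𝓝[≠] t := nhdsWithin_mono t fun τ (hτ : τ < t) => hτ.ne
  have hne2 : 𝓝[>] t ≤ 𝓝[≠] t := nhdsWithin_mono t fun τ (hτ : t < τ) => hτ.ne'
  have hBa := (hlim.mono_left hne1).comp ha
  have hBb := (hlim.mono_left hne2).comp hb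
  have hprim : ContinuousAt (fun s => ∫ τ in (t - Real.pi)..s, r τ) t := by
    have h1 := intervalIntegral.continuousOn_primitive_interval (μ := MeasureTheory.volume)
      (f := r) (a := t - Real.pi) (b := t + Real.pi)
      (by rw [uIcc_of_le (by linarith)]; exact hr.integrableOn_Icc)
    rw [uIcc_of_le (by linarith)] at h1
    exact h1.continuousAt (Icc_mem_nhds (by linarith) (by linarith))
  have hRa := hprim.tendsto.comp (ha.mono_right nhdsWithin_le_nhds)
  have hRb := hprim.tendsto.comp (hb.mono_right nhdsWithin_le_nhds)
  -- The signed distance is -ε at a(ε) and ε at b(ε). In A(a) - A(b) the odd term contributes α/ε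
  -- from each end, while the logarithms cancel.
  refine ⟨2 * α, ?_⟩
  have hmain := ((hBa.sub hBb).add hRa).add
    ((tendsto_const_nhds (x := ∫ τ in (t - Real.pi)..(t + Real.pi), r τ)).sub hRb)
  have hval : L - L + (∫ τ in (t - Real.pi)..t, r τ) + ((∫ τ in (t - Real.pi)..(t + Real.pi), r τ)
      - ∫ τ in (t - Real.pi)..t, r τ) = ∫ τ in (t - Real.pi)..(t + Real.pi), r τ := by ring
  rw [hval] at hmain
  refine hmain.congr' ?_
  have hIa : ∀ᶠ ε in 𝓝[>] (0 : ℝ), a ε ∈ Ioo (t - Real.pi) t :=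
    ha.eventually (Ioo_mem_nhdsLT (by linarith))
  have hIb : ∀ᶠ ε in 𝓝[>] (0 : ℝ), b ε ∈ Ioo t (t + Real.pi) :=
    hb.eventually (Ioo_mem_nhdsGT (by linarith))
  filter_upwards [hab, hIa, hIb, self_mem_nhdsWithin] with ε ⟨h1, h2, h3⟩ h4 h5 h6
  change 0 < ε at h6
  obtain ⟨h7, h8⟩ := hpiece (t - Real.pi) (a ε) h4.1.le fun τ hτ =>
    ⟨⟨hτ.1, by linarith [hτ.2, h4.2]⟩, (hτ.2.trans_lt h4.2).ne⟩
  obtain ⟨h9, h10⟩ := hpiece (b ε) (t + Real.pi) h5.2.le fun τ hτ =>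
    ⟨⟨by linarith [hτ.1, h5.1], hτ.2⟩, (h5.1.trans_le hτ.1).ne'⟩
  rw [hz.setIntegral_truncated_eq hk ⟨h4.1.le, h4.2.le⟩ ⟨h5.1.le, h5.2.le⟩ h3 h7 h9, h8, h10]
  have h11 : (∫ τ in (t - Real.pi)..(t + Real.pi), r τ) - ∫ τ in (t - Real.pi)..(b ε), r τ
      = ∫ τ in (b ε)..(t + Real.pi), r τ := by
    apply intervalIntegral.integral_interval_sub_left hrint
    apply hrint.mono_set
    rw [uIcc_of_le (by linarith [h5.1]), uIcc_of_le (by linarith)]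
    exact Icc_subset_Icc_right h5.2.le
  simp only [Function.comp_apply, hB]
  rw [h11, ← abs_signedDist, ← abs_signedDist, h1, h2, abs_neg, hper, div_neg]
  ring

end IsRegularLoop

/-! ### The dipole singularity and Green's identity in complex form. -/

theorem hasDerivAt_re_comp {g : ℝ → ℂ} {g' : ℂ} {τ : ℝ} (hg : HasDerivAt g g' τ) :
    HasDerivAt (fun s => (g s).re) g'.re τ :=
  Complex.reCLM.hasFDerivAt.comp_hasDerivAt τ hg

theorem hasDerivAt_im_comp {g : ℝ → ℂ} {g' : ℂ} {τ : ℝ} (hg : HasDerivAt g g' τ) :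
    HasDerivAt (fun s => (g s).im) g'.im τ :=
  Complex.imCLM.hasFDerivAt.comp_hasDerivAt τ hg

theorem hasDerivAt_norm_comp {g : ℝ → ℂ} {g' : ℂ} {τ : ℝ} (hg : HasDerivAt g g' τ)
    (h0 : g τ ≠ 0) : HasDerivAt (fun s => ‖g s‖) (inner ℝ (g τ) g' / ‖g τ‖) τ := by
  have h1 := (hg.norm_sq).sqrt (pow_ne_zero 2 (norm_ne_zero_iff.2 h0))
  simp only [Real.sqrt_sq (norm_nonneg _)] at h1
  refine h1.congr_deriv ?_
  rw [mul_div_mul_left _ _ two_ne_zero]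

theorem hasDerivAt_log_norm_comp {g : ℝ → ℂ} {g' : ℂ} {τ : ℝ} (hg : HasDerivAt g g' τ)
    (h0 : g τ ≠ 0) : HasDerivAt (fun s => Real.log ‖g s‖) (g' / g τ).re τ := by
  have h1 := (hasDerivAt_norm_comp hg h0).log (norm_ne_zero_iff.2 h0)
  refine h1.congr_deriv ?_
  rw [div_div, ← pow_two, ← Complex.normSq_eq_norm_sq, Complex.inner, Complex.div_re,
    Complex.mul_re, Complex.conj_re, Complex.conj_im]
  ring

/-- The function `z τ ↦ ν / (z τ - z t)`, for `ν` the unit normal at `z t`, has a purely imaginary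
singularity at `τ = t`: the reciprocal of the signed distance. -/
theorem IsRegularLoop.tendsto_im_normal_div_add {z : ℝ → ℂ} (hz : IsRegularLoop z) (t : ℝ) {ν : ℂ}
    (hν : ν = -Complex.I * deriv z t / ‖deriv z t‖) :
    Tendsto (fun τ => (ν / (z τ - z t)).im + 1 / ((τ - t) * ‖dslope z t τ‖)) (𝓝[≠] t) (𝓝 0) := by
  have hT := hz.regular t
  have hn : ‖deriv z t‖ ≠ 0 := norm_ne_zero_iff.2 hT
  have hnC : (‖deriv z t‖ : ℂ) ≠ 0 := by exact_mod_cast hn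
  have hDt : dslope z t t = deriv z t := dslope_same z t
  have hD := hz.hasDerivAt_dslope t t
  have hD0 : dslope z t t ≠ 0 := by rw [hDt]; exact hT
  -- The expression in the limit is the difference quotient at t of this function, which vanishes
  -- there. Since ν/D(t) = -i/|D(t)|, the two terms have derivatives ± Re(D'/D)/|D| at t and cancel.
  have h1 : HasDerivAt (fun τ => (ν / dslope z t τ).im + 1 / ‖dslope z t τ‖) 0 t := by
    have h2 := (hasDerivAt_im_comp ((hasDerivAt_const t ν).div hD hD0)).add
      ((hasDerivAt_const t (1 : ℝ)).div (hasDerivAt_norm_comp hD hD0) (norm_ne_zero_iff.2 hD0))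
    refine h2.congr_deriv ?_
    rw [hDt, hν, Complex.inner]
    have h3 : (0 * deriv z t - -Complex.I * deriv z t / ‖deriv z t‖ * deriv (dslope z t) t)
        / deriv z t ^ 2 = Complex.I * (deriv (dslope z t) t / deriv z t) / ‖deriv z t‖ := by
      field_simp
      ring
    rw [h3, Complex.div_ofReal_im, Complex.I_mul_im, Complex.div_re, Complex.normSq_eq_norm_sq,
      Complex.mul_re, Complex.conj_re, Complex.conj_im]
    field_simp
    ring
  have h4 := hasDerivAt_iff_tendsto_slope.1 h1
  refine h4.congr' ?_
  filter_upwards [self_mem_nhdsWithin] with τ hτ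
  have hτ' : τ - t ≠ 0 := sub_ne_zero.2 hτ
  have h5 : (ν / dslope z t t).im + 1 / ‖dslope z t t‖ = 0 := by
    rw [hDt, hν]
    have h6 : -Complex.I * deriv z t / ‖deriv z t‖ / deriv z t = -Complex.I / ‖deriv z t‖ := by
      field_simp
    rw [h6, Complex.div_ofReal_im]
    simp
    ring
  rw [slope_def_field, h5, sub_zero, ← sub_smul_dslope, Complex.real_smul, mul_comm, ← div_div,
    Complex.div_ofReal_im, mul_comm (τ - t), ← div_div, add_div]

/-- The number ν/z'(t) is purely imaginary. This removes the boundary term Im f · Re(ν/(z - p)),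
where Im f vanishes at p. -/
theorem IsRegularLoop.tendsto_re_normal_div {z : ℝ → ℂ} (hz : IsRegularLoop z) (t : ℝ) {ν : ℂ}
    (hν : ν = -Complex.I * deriv z t / ‖deriv z t‖) :
    Tendsto (fun τ => (τ - t) * (ν / (z τ - z t)).re) (𝓝[≠] t) (𝓝 0) := by
  have hT := hz.regular t
  have hDt : dslope z t t = deriv z t := dslope_same z t
  have h1 : ContinuousAt (fun τ => (ν / dslope z t τ).re) t := by
    refine Complex.continuous_re.continuousAt.comp ?_
    refine continuousAt_const.div (hz.continuous_dslope t).continuousAt ?_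
    rw [hDt]
    exact hT
  have h2 : (ν / dslope z t t).re = 0 := by
    rw [hDt, hν]
    have h6 : -Complex.I * deriv z t / ‖deriv z t‖ / deriv z t = -Complex.I / ‖deriv z t‖ := by
      field_simp
    rw [h6, Complex.div_ofReal_re]
    simp
  have h3 := h1.tendsto.mono_left (nhdsWithin_le_nhds (s := {t}ᶜ))
  rw [h2] at h3
  refine h3.congr' ?_
  filter_upwards [self_mem_nhdsWithin] with τ hτ
  have hτ' : τ - t ≠ 0 := sub_ne_zero.2 hτ
  rw [← sub_smul_dslope, Complex.real_smul, mul_comm ((τ - t : ℝ) : ℂ), ← div_div,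
    Complex.div_ofReal_re, mul_div_cancel₀ _ hτ']

/-- Finite part of the integral of the normal derivative of a dipole potential against a harmonic
function `Re f`, by Green's second identity in complex form. -/
theorem IsRegularLoop.hasFinitePart_dipole {z : ℝ → ℂ} (hz : IsRegularLoop z) {t : ℝ}
    (hangle : chordAngle z t = Real.pi) {ν : ℂ}
    (hν : ν = -Complex.I * deriv z t / ‖deriv z t‖) {f : ℂ → ℂ} (hf : Differentiable ℂ f)
    (hf0 : (f (z t)).im = 0) {k r : ℝ → ℝ} (hk : Function.Periodic k (2 * Real.pi))
    (hr : ContinuousOn r (Icc (t - Real.pi) (t + Real.pi)))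
    (hkr : ∀ τ ∈ Icc (t - Real.pi) (t + Real.pi), τ ≠ t →
      k τ = -(1 / (2 * Real.pi)) * (ν * deriv z τ / (z τ - z t) ^ 2).im * (f (z τ)).re
        - 1 / (2 * Real.pi) * (ν / (z τ - z t)).re * (deriv f (z τ) * deriv z τ).im + r τ) :
    HasFinitePart
      (fun ε => ∫ τ in {τ | τ ∈ Ico 0 (2 * Real.pi) ∧ ε < ‖z t - z τ‖}, k τ)
      (-(ν * deriv f (z t)).re / 2 + ∫ τ in (t - Real.pi)..(t + Real.pi), r τ) := by
  have hpi := Real.pi_pos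
  set p := z t with hp
  set D := dslope z t with hD
  set h : ℂ → ℂ := dslope (dslope f p) p with hh
  have hh1 : Differentiable ℂ (dslope f p) := by
    rw [← differentiableOn_univ, Complex.differentiableOn_dslope univ_mem]
    exact hf.differentiableOn
  have hh2 : Differentiable ℂ h := by
    rw [← differentiableOn_univ, hh, Complex.differentiableOn_dslope univ_mem]
    exact hh1.differentiableOn
  -- A primitive of the entire quotient h makes its term integrate to zero around the loop.
  obtain ⟨H, hH⟩ := hh2.isExactOn_univ
  have htaylor : ∀ w, f w = f p + deriv f p * (w - p) + h w * (w - p) ^ 2 := by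
    intro w
    have h1 := sub_smul_dslope f p w
    have h2 := sub_smul_dslope (dslope f p) p w
    rw [dslope_same] at h2
    simp only [smul_eq_mul] at h1 h2
    linear_combination -h1 - (w - p) * h2
  have hzd := hasDerivAt_of_analyticOnNhd hz.analytic
  have hne : ∀ τ ∈ Icc (t - Real.pi) (t + Real.pi), τ ≠ t → z τ - p ≠ 0 := by
    intro τ hτ hτt
    rw [hp, ← sub_smul_dslope]
    exact smul_ne_zero (sub_ne_zero.2 hτt) (hz.dslope_ne_zero_of_mem hτ)
  have hfz : ∀ τ, HasDerivAt (fun s => f (z s)) (deriv f (z τ) * deriv z τ) τ := fun τ =>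
    (hf (z τ)).hasDerivAt.comp_of_eq τ (hzd τ) rfl
  have hHz : ∀ τ, HasDerivAt (fun s => H (z s)) (h (z τ) * deriv z τ) τ := fun τ =>
    (hH (z τ) (mem_univ _)).comp_of_eq τ (hzd τ) rfl
  -- A collects the exact terms of the Green integrand: f(p) times the dipole, the logarithm, and
  -- the boundary term. The non-exact turning of the chord and the h term go into ρ below, which is
  -- continuous across t.
  set A : ℝ → ℝ := fun τ => 1 / (2 * Real.pi) * ((f p).re * (ν / (z τ - p)).im
    - (ν * deriv f p).im * Real.log ‖z τ - p‖ - (f (z τ)).im * (ν / (z τ - p)).re) with hA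
  set A' : ℝ → ℝ := fun τ => 1 / (2 * Real.pi) * (-(f p).re * (ν * deriv z τ / (z τ - p) ^ 2).im
    - (ν * deriv f p).im * (deriv z τ / (z τ - p)).re
    - ((deriv f (z τ) * deriv z τ).im * (ν / (z τ - p)).re
      - (f (z τ)).im * (ν * deriv z τ / (z τ - p) ^ 2).re)) with hA'
  set ρ : ℝ → ℝ := fun τ => -(1 / (2 * Real.pi)) * ((ν * deriv f p).re * (deriv D τ / D τ).im
    + (ν * (h (z τ) * deriv z τ)).im) with hρ
  have hcz := hz.continuous
  have hcz' := hz.continuous_deriv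
  have hcf := hf.continuous
  have hcf' : Continuous (deriv f) := (hf.contDiff (n := 1)).continuous_deriv le_rfl
  have hch := hh2.continuous
  have hAd : ∀ τ ∈ Icc (t - Real.pi) (t + Real.pi), τ ≠ t → HasDerivAt A (A' τ) τ := by
    intro τ hτ hτt
    have h0 := hne τ hτ hτt
    have h1 : HasDerivAt (fun s => ν / (z s - p)) (-(ν * deriv z τ / (z τ - p) ^ 2)) τ := by
      refine ((hasDerivAt_const τ ν).div ((hzd τ).sub_const p) h0).congr_deriv ?_
      rw [zero_mul, zero_sub, neg_div]
    have h2 := hasDerivAt_log_norm_comp ((hzd τ).sub_const p) h0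
    have h3 := ((((hasDerivAt_im_comp h1).const_mul (f p).re).sub
      (h2.const_mul (ν * deriv f p).im)).sub
        ((hasDerivAt_im_comp (hfz τ)).mul (hasDerivAt_re_comp h1))).const_mul (1 / (2 * Real.pi))
    refine h3.congr_deriv ?_
    simp only [hA', Complex.neg_im, Complex.neg_re]
    ring
  have hA'c : ContinuousOn A' (Icc (t - Real.pi) (t + Real.pi) \ {t}) := by
    have h0 : ∀ τ ∈ Icc (t - Real.pi) (t + Real.pi) \ {t}, z τ - p ≠ 0 := fun τ hτ =>
      hne τ hτ.1 hτ.2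
    have h00 : ∀ τ ∈ Icc (t - Real.pi) (t + Real.pi) \ {t}, (z τ - p) ^ 2 ≠ 0 := fun τ hτ =>
      pow_ne_zero 2 (h0 τ hτ)
    have h1 : ContinuousOn (fun τ => ν * deriv z τ / (z τ - p) ^ 2)
        (Icc (t - Real.pi) (t + Real.pi) \ {t}) :=
      ContinuousOn.div (by fun_prop) (by fun_prop) h00
    have h2 : ContinuousOn (fun τ => deriv z τ / (z τ - p))
        (Icc (t - Real.pi) (t + Real.pi) \ {t}) :=
      ContinuousOn.div (by fun_prop) (by fun_prop) h0
    have h3 : ContinuousOn (fun τ => ν / (z τ - p))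
        (Icc (t - Real.pi) (t + Real.pi) \ {t}) :=
      ContinuousOn.div (by fun_prop) (by fun_prop) h0
    have hre := Complex.continuous_re
    have him := Complex.continuous_im
    have h4 := him.comp_continuousOn h1
    have h5 := hre.comp_continuousOn h2
    have h6 := hre.comp_continuousOn h3
    have h7 := hre.comp_continuousOn h1
    have h8 : Continuous fun τ => (deriv f (z τ) * deriv z τ).im := by fun_prop
    have h9 : Continuous fun τ => (f (z τ)).im := by fun_prop
    exact continuousOn_const.mul (((continuousOn_const.mul h4).sub (continuousOn_const.mul h5)).sub
      ((h8.continuousOn.mul h6).sub (h9.continuousOn.mul h7)))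
  have hlogc := Complex.continuous_im.comp_continuousOn (hz.continuousOn_logDeriv_dslope t)
  have hhc : Continuous fun τ => h (z τ) * deriv z τ := by fun_prop
  have hρc : ContinuousOn ρ (Icc (t - Real.pi) (t + Real.pi)) :=
    continuousOn_const.mul ((continuousOn_const.mul hlogc).add
      (Complex.continuous_im.comp (continuous_const.mul hhc)).continuousOn)
  have hzpi : z (t - Real.pi) = z (t + Real.pi) := by
    rw [← hz.periodic (t - Real.pi)]
    congr 1
    ring
  have hle : t - Real.pi ≤ t + Real.pi := by linarith
  have hρint : ∫ τ in (t - Real.pi)..(t + Real.pi), ρ τ = -(ν * deriv f p).re / 2 := by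
    have h1 : ∫ τ in (t - Real.pi)..(t + Real.pi), h (z τ) * deriv z τ = 0 := by
      rw [intervalIntegral.integral_eq_sub_of_hasDerivAt (fun τ _ => hHz τ)
        (hhc.intervalIntegrable _ _), hzpi, sub_self]
    have h2 : ∫ τ in (t - Real.pi)..(t + Real.pi), (ν * (h (z τ) * deriv z τ)).im = 0 := by
      have h3 := Complex.imCLM.intervalIntegral_comp_comm
        ((continuous_const (y := ν)).mul hhc |>.intervalIntegrable (t - Real.pi) (t + Real.pi)
          (μ := MeasureTheory.volume))
      simp only [Complex.imCLM_apply, Pi.mul_apply] at h3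
      rw [h3, intervalIntegral.integral_const_mul, h1, mul_zero, Complex.zero_im]
    have h4 : IntervalIntegrable (fun τ => (ν * deriv f p).re * (deriv D τ / D τ).im)
        MeasureTheory.volume (t - Real.pi) (t + Real.pi) := by
      apply ContinuousOn.intervalIntegrable
      rw [uIcc_of_le hle]
      exact continuousOn_const.mul hlogc
    have h5 : IntervalIntegrable (fun τ => (ν * (h (z τ) * deriv z τ)).im)
        MeasureTheory.volume (t - Real.pi) (t + Real.pi) :=
      (Complex.continuous_im.comp (continuous_const.mul hhc)).intervalIntegrable _ _
    simp only [hρ]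
    rw [intervalIntegral.integral_const_mul, intervalIntegral.integral_add h4 h5, h2,
      intervalIntegral.integral_const_mul]
    rw [chordAngle, ← hD] at hangle
    rw [hangle]
    field_simp
    ring
  have hlim : Tendsto (fun τ => A τ + (1 / (2 * Real.pi) * (f p).re) / ((τ - t) * ‖dslope z t τ‖)
      + (1 / (2 * Real.pi) * (ν * deriv f p).im) * Real.log ‖z t - z τ‖) (𝓝[≠] t) (𝓝 0) := by
    have h1 := hz.tendsto_im_normal_div_add t hν
    have h2 := hz.tendsto_re_normal_div t hν
    have h3 := hasDerivAt_iff_tendsto_slope.1 (hasDerivAt_im_comp (hfz t))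
    have h4 := ((h1.const_mul (f p).re).sub (h3.mul h2)).const_mul (1 / (2 * Real.pi))
    simp only [mul_zero, sub_zero] at h4
    refine h4.congr' ?_
    filter_upwards [self_mem_nhdsWithin] with τ hτ
    have hτ' : τ - t ≠ 0 := sub_ne_zero.2 hτ
    rw [slope_def_field, hf0, sub_zero, norm_sub_rev (z t), ← hp]
    simp only [hA]
    field_simp
    ring
  have key := hz.hasFinitePart_of_primitive (r := fun τ => ρ τ + r τ) hk (hρc.add hr) hAd hA'c
    (by simp only [hA, hzpi]) (by
      intro τ hτ hτt
      rw [hkr τ hτ hτt]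
      suffices hs : -(1 / (2 * Real.pi)) * (ν * deriv z τ / (z τ - p) ^ 2).im * (f (z τ)).re
          - 1 / (2 * Real.pi) * (ν / (z τ - p)).re * (deriv f (z τ) * deriv z τ).im
          = A' τ + ρ τ by
        rw [hs, add_assoc]
      have h0 := hne τ hτ hτt
      have hD0 : D τ ≠ 0 := hz.dslope_ne_zero_of_mem hτ
      -- The logarithmic derivatives of D and z - p differ by the real number 1/(τ - t).
      have h1 : (deriv D τ / D τ).im = (deriv z τ / (z τ - p)).im := by
        have h2 : z τ - p = ((τ - t : ℝ) : ℂ) * D τ := by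
          rw [hp, hD, ← Complex.real_smul, sub_smul_dslope]
        have h3 : deriv z τ = D τ + ((τ - t : ℝ) : ℂ) * deriv D τ := by
          rw [deriv_eq_dslope_add hz.analytic t τ, Complex.real_smul]
        have hτ' : ((τ - t : ℝ) : ℂ) ≠ 0 := by exact_mod_cast sub_ne_zero.2 hτt
        have h4 : deriv z τ / (z τ - p) = ((1 / (τ - t) : ℝ) : ℂ) + deriv D τ / D τ := by
          rw [h2, h3]
          push_cast at hτ' ⊢
          field_simp
        rw [h4, Complex.add_im, Complex.ofReal_im, zero_add]
      have hfp : f p = ((f p).re : ℂ) := Complex.ext (by simp) (by simp [hf0])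
      -- The Taylor expansion times ν z'/(z - p)². In the imaginary part, f(p) is real and factors
      -- out, and the middle product splits into a logarithm and a turning term.
      have h5 : f (z τ) * (ν * deriv z τ / (z τ - p) ^ 2)
          = ((f p).re : ℂ) * (ν * deriv z τ / (z τ - p) ^ 2)
            + (ν * deriv f p) * (deriv z τ / (z τ - p)) + ν * (h (z τ) * deriv z τ) := by
        rw [htaylor (z τ), ← hfp]
        field_simp
      have h6 := congrArg Complex.im h5
      simp only [Complex.add_im, Complex.im_ofReal_mul] at h6
      rw [Complex.mul_im, Complex.mul_im (ν * deriv f p)] at h6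
      simp only [hA', hρ]
      rw [h1]
      linear_combination (-(1 / (2 * Real.pi))) * h6) hlim
  have hfin : ∫ τ in (t - Real.pi)..(t + Real.pi), (ρ τ + r τ)
      = -(ν * deriv f p).re / 2 + ∫ τ in (t - Real.pi)..(t + Real.pi), r τ := by
    rw [intervalIntegral.integral_add, hρint]
    · apply ContinuousOn.intervalIntegrable
      rwa [uIcc_of_le hle]
    · apply ContinuousOn.intervalIntegrable
      rwa [uIcc_of_le hle]
  rwa [hfin] at key

/-! ### From the Euclidean plane to ℂ, and harmonic functions as real parts. -/

/-- The isometric identification of the Euclidean plane with `ℂ`. -/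
def toComplex : Plane ≃ₗᵢ[ℝ] ℂ := Complex.orthonormalBasisOneI.repr.symm

theorem toComplex_apply (p : Plane) : toComplex p = p 0 + p 1 * Complex.I :=
  Complex.orthonormalBasisOneI_repr_symm_apply p

theorem toComplex_re (p : Plane) : (toComplex p).re = p 0 := by simp [toComplex_apply]

theorem toComplex_im (p : Plane) : (toComplex p).im = p 1 := by simp [toComplex_apply]

theorem inner_eq_toComplex (p q : Plane) :
    inner ℝ p q = (toComplex p).re * (toComplex q).re + (toComplex p).im * (toComplex q).im := by
  rw [← toComplex.inner_map_map, Complex.inner, Complex.mul_re, Complex.conj_re, Complex.conj_im]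
  ring

theorem hasDerivAt_toComplex {x : ℝ → Plane} {x' : Plane} {τ : ℝ} (h : HasDerivAt x x' τ) :
    HasDerivAt (fun s => toComplex (x s)) (toComplex x') τ :=
  toComplex.toContinuousLinearEquiv.hasFDerivAt.comp_hasDerivAt τ h

/-- The Laplacian can be computed in any orthonormal basis, and e carries one such basis to another.
-/
theorem laplacian_comp_linearIsometryEquiv {E E' F : Type*} [NormedAddCommGroup E]
    [InnerProductSpace ℝ E] [FiniteDimensional ℝ E] [NormedAddCommGroup E']
    [InnerProductSpace ℝ E'] [FiniteDimensional ℝ E'] [NormedAddCommGroup F] [NormedSpace ℝ F]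
    {u : E → F} (hu : ContDiff ℝ 2 u) (e : E' ≃ₗᵢ[ℝ] E) (w : E') :
    Laplacian.laplacian (u ∘ e) w = Laplacian.laplacian u (e w) := by
  rw [InnerProductSpace.laplacian_eq_iteratedFDeriv_orthonormalBasis _ (stdOrthonormalBasis ℝ E'),
    InnerProductSpace.laplacian_eq_iteratedFDeriv_orthonormalBasis _
      ((stdOrthonormalBasis ℝ E').map e)]
  refine Finset.sum_congr rfl fun i _ => ?_
  have h1 := e.toContinuousLinearEquiv.toContinuousLinearMap.iteratedFDeriv_comp_right hu w
    (i := 2) le_rfl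
  have h2 : iteratedFDeriv ℝ 2 (u ∘ e) w
      = (iteratedFDeriv ℝ 2 u (e w)).compContinuousLinearMap
        fun _ => e.toContinuousLinearEquiv.toContinuousLinearMap := h1
  rw [h2, ContinuousMultilinearMap.compContinuousLinearMap_apply]
  congr 1
  funext j
  fin_cases j <;> simp

theorem harmonicOnNhd_univ_comp_linearIsometryEquiv {E E' F : Type*} [NormedAddCommGroup E]
    [InnerProductSpace ℝ E] [FiniteDimensional ℝ E] [NormedAddCommGroup E']
    [InnerProductSpace ℝ E'] [FiniteDimensional ℝ E'] [NormedAddCommGroup F] [NormedSpace ℝ F]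
    {u : E → F} (hu : InnerProductSpace.HarmonicOnNhd u univ) (e : E' ≃ₗᵢ[ℝ] E) :
    InnerProductSpace.HarmonicOnNhd (u ∘ e) univ := by
  have hc : ContDiff ℝ 2 u := contDiff_iff_contDiffAt.2 fun q => (hu q (mem_univ q)).1
  intro w _
  refine ⟨(hc.comp e.contDiff).contDiffAt, Eventually.of_forall fun w => ?_⟩
  rw [laplacian_comp_linearIsometryEquiv hc]
  exact (hu (e w) (mem_univ _)).2.self_of_nhds

/-- A harmonic function in the plane is the real part of an entire function, which may be taken to
be real at a given point. -/
theorem exists_entire_re_eq {u : Plane → ℝ} (hu : InnerProductSpace.HarmonicOnNhd u univ) (w : ℂ) :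
    ∃ f : ℂ → ℂ, Differentiable ℂ f ∧ (∀ q, u q = (f (toComplex q)).re) ∧ (f w).im = 0 := by
  obtain ⟨F, hF, hre⟩ :=
    (harmonicOnNhd_univ_comp_linearIsometryEquiv hu toComplex.symm).exists_analyticOnNhd_univ_re_eq
  refine ⟨fun v => F v - (F w).im * Complex.I, ?_, fun q => ?_, by simp⟩
  · exact fun v => (hF v (mem_univ v)).differentiableAt.sub_const _
  · have := congrFun hre (toComplex q)
    simp only [Function.comp_apply, LinearIsometryEquiv.symm_apply_apply] at this
    simp [← this]

theorem fderiv_re_comp_toComplex {f : ℂ → ℂ} (hf : Differentiable ℂ f) (q v : Plane) :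
    fderiv ℝ (fun q => (f (toComplex q)).re) q v
      = (deriv f (toComplex q) * toComplex v).re := by
  have h1 : HasFDerivAt f _ (toComplex q) :=
    (hf (toComplex q)).hasDerivAt.hasFDerivAt.restrictScalars ℝ
  have h2 := Complex.reCLM.hasFDerivAt.comp q
    (h1.comp q toComplex.toContinuousLinearEquiv.hasFDerivAt)
  have h3 : HasFDerivAt (fun q => (f (toComplex q)).re) _ q := h2
  rw [h3.fderiv]
  simp [mul_comm]

/-! ### The hypersingular kernel off the diagonal. -/

section Kernel

variable {E : Type*} [NormedAddCommGroup E] [InnerProductSpace ℝ E]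

theorem fderiv_apply_eq_of_hasDerivAt {f : E → ℝ} {p v : E} {c : ℝ} (hf : DifferentiableAt ℝ f p)
    (h : HasDerivAt (fun s : ℝ => f (p + s • v)) c 0) : fderiv ℝ f p v = c := by
  rw [← hf.lineDeriv_eq_fderiv]
  exact h.deriv

theorem hasDerivAt_add_smul (p v : E) (s : ℝ) : HasDerivAt (fun s : ℝ => p + s • v) v s := by
  simpa using ((hasDerivAt_id s).smul_const v).const_add p

theorem fderiv_log_norm_sub {p q : E} (h : p ≠ q) (v : E) :
    fderiv ℝ (fun q => Real.log ‖p - q‖) q v = -(inner ℝ (p - q) v / ‖p - q‖ ^ 2) := by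
  have h0 : p - q ≠ 0 := sub_ne_zero.2 h
  have hd : DifferentiableAt ℝ (fun q => Real.log ‖p - q‖) q :=
    ((differentiableAt_const p).sub differentiableAt_id).norm ℝ h0 |>.log (norm_ne_zero_iff.2 h0)
  refine fderiv_apply_eq_of_hasDerivAt hd ?_
  have h1 := (((hasDerivAt_add_smul q v 0).const_sub p).norm_sq).log
    (pow_ne_zero 2 (norm_ne_zero_iff.2 (by simpa using h0)))
  have h2 : (fun s : ℝ => Real.log ‖p - (q + s • v)‖)
      = fun s : ℝ => 1 / 2 * Real.log (‖p - (q + s • v)‖ ^ 2) := by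
    funext s
    rw [Real.log_pow]
    push_cast
    ring
  rw [h2]
  refine (h1.const_mul (1 / 2)).congr_deriv ?_
  simp only [zero_smul, add_zero, inner_neg_right]
  ring

theorem differentiableAt_inner_div_norm_sq {p q : E} (h : p ≠ q) (m : E) :
    DifferentiableAt ℝ (fun p => inner ℝ (p - q) m / ‖p - q‖ ^ 2) p := by
  have hs : DifferentiableAt ℝ (fun p => p - q) p := differentiableAt_id.sub_const q
  simp only [div_eq_mul_inv]
  exact (hs.inner ℝ (differentiableAt_const m)).mul
    ((hs.norm_sq ℝ).fun_inv (pow_ne_zero 2 (norm_ne_zero_iff.2 (sub_ne_zero.2 h))))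

theorem fderiv_inner_div_norm_sq {p q : E} (h : p ≠ q) (m v : E) :
    fderiv ℝ (fun p => inner ℝ (p - q) m / ‖p - q‖ ^ 2) p v
      = inner ℝ m v / ‖p - q‖ ^ 2 - 2 * inner ℝ (p - q) v * inner ℝ (p - q) m / ‖p - q‖ ^ 4 := by
  have h0 : p - q ≠ 0 := sub_ne_zero.2 h
  have hn : ‖p - q‖ ≠ 0 := norm_ne_zero_iff.2 h0
  refine fderiv_apply_eq_of_hasDerivAt (differentiableAt_inner_div_norm_sq h m) ?_
  have hl : HasDerivAt (fun s : ℝ => p + s • v - q) v 0 := (hasDerivAt_add_smul p v 0).sub_const q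
  have h1 := (hl.inner ℝ (hasDerivAt_const (0 : ℝ) m)).div hl.norm_sq
    (pow_ne_zero 2 (norm_ne_zero_iff.2 (by simpa using h0)))
  refine h1.congr_deriv ?_
  simp only [zero_smul, add_zero, inner_zero_right, zero_add, real_inner_comm v m]
  field_simp

end Kernel

theorem hypersingularKernel_eq {x : ℝ → Plane} {τ t : ℝ} (h : x t ≠ x τ) :
    hypersingularKernel x τ t
      = inner ℝ (normal x τ) (normal x t) / (2 * Real.pi * ‖x t - x τ‖ ^ 2)
        - inner ℝ (x t - x τ) (normal x t) * inner ℝ (x t - x τ) (normal x τ)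
          / (Real.pi * ‖x t - x τ‖ ^ 4) := by
  have hpi := Real.pi_pos
  -- The inner derivative is needed on a neighbourhood of x(t), as it is differentiated again in p.
  have h1 : (fun p => fderiv ℝ (fun q => green p q) (x τ) (normal x τ)) =ᶠ[𝓝 (x t)]
      fun p => (1 / (2 * Real.pi)) • (inner ℝ (p - x τ) (normal x τ) / ‖p - x τ‖ ^ 2) := by
    filter_upwards [isOpen_ne.mem_nhds h] with p hp
    have h2 : (fun q => green p q) = fun q => (-(1 / (2 * Real.pi))) • Real.log ‖p - q‖ := rfl
    have h0 : p - x τ ≠ 0 := sub_ne_zero.2 hp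
    have hd : DifferentiableAt ℝ (fun q => Real.log ‖p - q‖) (x τ) :=
      ((differentiableAt_const p).sub differentiableAt_id).norm ℝ h0 |>.log
        (norm_ne_zero_iff.2 h0)
    rw [h2, fderiv_fun_const_smul hd, smul_apply, fderiv_log_norm_sub hp]
    simp only [smul_eq_mul]
    ring
  have h0 : x t - x τ ≠ 0 := sub_ne_zero.2 h
  have hn : ‖x t - x τ‖ ≠ 0 := norm_ne_zero_iff.2 h0
  rw [hypersingularKernel, h1.fderiv_eq,
    fderiv_fun_const_smul (differentiableAt_inner_div_norm_sq h _), smul_apply, fderiv_inner_div_norm_sq h]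
  simp only [smul_eq_mul]
  field_simp

theorem toComplex_normal (x : ℝ → Plane) (t : ℝ) :
    toComplex (normal x t)
      = -Complex.I * toComplex (deriv x t) / ‖toComplex (deriv x t)‖ := by
  rw [normal, map_smul, LinearIsometryEquiv.norm_map]
  apply Complex.ext
  · rw [Complex.smul_re, Complex.div_ofReal_re, toComplex_re]
    simp [toComplex_im]
    ring
  · rw [Complex.smul_im, Complex.div_ofReal_im, toComplex_im]
    simp [toComplex_re]
    ring

namespace IsAnalyticSimpleClosedCurve

variable {x : ℝ → Plane}

theorem deriv_toComplex (hx : IsAnalyticSimpleClosedCurve x) (τ : ℝ) :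
    deriv (fun s => toComplex (x s)) τ = toComplex (deriv x τ) :=
  (hasDerivAt_toComplex (hasDerivAt_of_analyticOnNhd hx.analytic τ)).deriv

theorem isRegularLoop (hx : IsAnalyticSimpleClosedCurve x) :
    IsRegularLoop fun s => toComplex (x s) where
  analytic := fun τ _ =>
    (toComplex.toContinuousLinearEquiv.toContinuousLinearMap.analyticAt (x τ)).comp
      (hx.analytic τ (mem_univ τ))
  periodic := fun τ => by simp only [hx.periodic τ]
  regular := fun t => by
    rw [hx.deriv_toComplex]
    exact fun h => hx.regular t (toComplex.map_eq_zero_iff.1 h)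
  simple := fun a ha b hb h => hx.simple ha hb (toComplex.injective h)

theorem chordAngle_eq_pi (hx : IsAnalyticSimpleClosedCurve x) (t : ℝ) :
    chordAngle (fun s => toComplex (x s)) t = Real.pi := by
  obtain ⟨p, hp, hw⟩ := hx.counterclockwise
  refine hx.isRegularLoop.chordAngle_eq_pi (p := toComplex p) ?_ ?_ t
  · rintro ⟨τ, hτ⟩
    exact hp ⟨τ, toComplex.injective hτ⟩
  · have hpi := Real.pi_pos
    rw [windingNumber] at hw
    have h1 : ∀ τ, (deriv (fun s => toComplex (x s)) τ / (toComplex (x τ) - toComplex p)).im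
        = ((x τ 0 - p 0) * deriv x τ 1 - (x τ 1 - p 1) * deriv x τ 0) / ‖x τ - p‖ ^ 2 := by
      intro τ
      rw [hx.deriv_toComplex, ← map_sub, Complex.div_im, Complex.normSq_eq_norm_sq,
        LinearIsometryEquiv.norm_map]
      simp only [toComplex_re, toComplex_im, PiLp.sub_apply]
      ring
    simp only [h1]
    field_simp at hw
    exact hw

/-- The hypersingular kernel in complex form. -/
theorem hypersingularKernel_mul_norm (hx : IsAnalyticSimpleClosedCurve x) {τ t : ℝ}
    (h : x t ≠ x τ) :
    hypersingularKernel x τ t * ‖deriv x τ‖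
      = -(1 / (2 * Real.pi)) * (toComplex (normal x t) * deriv (fun s => toComplex (x s)) τ
        / (toComplex (x τ) - toComplex (x t)) ^ 2).im := by
  have hpi := Real.pi_pos
  have hn : ‖deriv x τ‖ ≠ 0 := norm_ne_zero_iff.2 (hx.regular τ)
  have hd0 : x t - x τ ≠ 0 := sub_ne_zero.2 h
  have hdn : ‖x t - x τ‖ ≠ 0 := norm_ne_zero_iff.2 hd0
  have hnormal : normal x τ = ‖deriv x τ‖⁻¹ • !₂[deriv x τ 1, -deriv x τ 0] := rfl
  rw [hypersingularKernel_eq h, hx.deriv_toComplex, hnormal, inner_smul_left, inner_smul_right]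
  set ν := normal x t
  set d := x t - x τ with hd
  set m : Plane := !₂[deriv x τ 1, -deriv x τ 0]
  have hm0 : m 0 = deriv x τ 1 := rfl
  have hm1 : m 1 = -deriv x τ 0 := rfl
  have h1 : (toComplex (x τ) - toComplex (x t)) ^ 2 = toComplex d ^ 2 := by
    rw [← neg_sq, neg_sub, hd, map_sub]
  have hns : ‖d‖ ^ 2 = d 0 ^ 2 + d 1 ^ 2 := by
    rw [← toComplex.norm_map, ← Complex.normSq_eq_norm_sq, Complex.normSq_apply, toComplex_re,
      toComplex_im]
    ring
  have hns4 : ‖d‖ ^ 4 = (d 0 ^ 2 + d 1 ^ 2) ^ 2 := by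
    rw [← hns]
    ring
  have hpos : d 0 ^ 2 + d 1 ^ 2 ≠ 0 := by
    rw [← hns]
    exact pow_ne_zero 2 hdn
  rw [h1, Complex.div_im, map_pow, Complex.normSq_eq_norm_sq, LinearIsometryEquiv.norm_map,
    inner_eq_toComplex m, inner_eq_toComplex d, inner_eq_toComplex d, hns, hns4]
  simp only [toComplex_re, toComplex_im, hm0, hm1, Complex.mul_im, Complex.mul_re,
    pow_two (toComplex d), conj_trivial]
  field_simp
  ring

end IsAnalyticSimpleClosedCurve

theorem neumannTrace_eq {x : ℝ → Plane} {U : Plane → range x → ℝ} {t : ℝ} {f : ℂ → ℂ}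
    (hf : Differentiable ℂ f)
    (hU : ∀ q, U q ⟨x t, mem_range_self t⟩ = (f (toComplex q)).re) (τ : ℝ) :
    neumannTrace x U τ t = (deriv f (toComplex (x τ)) * toComplex (normal x τ)).re := by
  have h1 : (fun p => U p ⟨x t, mem_range_self t⟩) = fun q => (f (toComplex q)).re := funext hU
  rw [neumannTrace, inner_gradient_left, h1, fderiv_re_comp_toComplex hf]

/-! ### Analyticity and periodicity of the regularized kernels. -/

section Analytic

variable {E : Type*} [NormedAddCommGroup E] [InnerProductSpace ℝ E] [CompleteSpace E]

theorem analyticAt_inner {f g : ℝ → E} {τ : ℝ} (hf : AnalyticAt ℝ f τ) (hg : AnalyticAt ℝ g τ) :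
    AnalyticAt ℝ (fun s => (inner ℝ (f s) (g s) : ℝ)) τ :=
  (hf.contDiffAt (n := ω).inner ℝ hg.contDiffAt).analyticAt

theorem analyticAt_norm {f : ℝ → E} {τ : ℝ} (hf : AnalyticAt ℝ f τ) (h0 : f τ ≠ 0) :
    AnalyticAt ℝ (fun s => ‖f s‖) τ :=
  (hf.contDiffAt (n := ω).norm ℝ h0).analyticAt

end Analytic

theorem SameParam.refl (t : ℝ) : SameParam t t := ⟨0, by simp⟩

theorem sameParam_add_period_iff {τ t : ℝ} : SameParam (τ + 2 * Real.pi) t ↔ SameParam τ t := by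
  constructor
  · rintro ⟨k, hk⟩
    exact ⟨k - 1, by push_cast; linarith⟩
  · rintro ⟨k, hk⟩
    exact ⟨k + 1, by push_cast; linarith⟩

theorem analyticOnNhd_of_periodic {F : ℝ → ℝ} (hF : Function.Periodic F (2 * Real.pi)) {t : ℝ}
    (ht : AnalyticAt ℝ F t) (hoff : ∀ τ, ¬SameParam τ t → AnalyticAt ℝ F τ) :
    AnalyticOnNhd ℝ F univ := by
  intro τ _
  by_cases h : SameParam τ t
  · obtain ⟨k, hk⟩ := h
    have h1 : F = F ∘ fun s => s - k * (2 * Real.pi) := by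
      funext s
      exact (hF.sub_int_mul_eq k).symm
    rw [h1]
    refine AnalyticAt.comp_of_eq ht (analyticAt_id.sub analyticAt_const) ?_
    rw [hk]
    simp
  · exact hoff τ h

theorem periodic_deriv {E : Type*} [NormedAddCommGroup E] [NormedSpace ℝ E] {f : ℝ → E} {c : ℝ}
    (hf : Function.Periodic f c) : Function.Periodic (deriv f) c := by
  intro τ
  rw [← deriv_comp_add_const]
  congr 1
  exact funext hf

namespace IsAnalyticSimpleClosedCurve

variable {x : ℝ → Plane}

theorem sameParam_iff (hx : IsAnalyticSimpleClosedCurve x) {τ t : ℝ} :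
    SameParam τ t ↔ x τ = x t := by
  refine ⟨?_, sameParam_of_eq hx.periodic hx.simple⟩
  rintro ⟨k, rfl⟩
  exact hx.periodic.int_mul k t

theorem continuous (hx : IsAnalyticSimpleClosedCurve x) : Continuous x :=
  continuous_iff_continuousAt.2 fun τ => (hx.analytic τ (mem_univ τ)).continuousAt

theorem eventually_not_sameParam (hx : IsAnalyticSimpleClosedCurve x) {τ t : ℝ}
    (h : ¬SameParam τ t) : ∀ᶠ s in 𝓝 τ, ¬SameParam s t := by
  rw [hx.sameParam_iff] at h
  filter_upwards [hx.continuous.continuousAt.eventually_ne h] with s hs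
  rwa [hx.sameParam_iff]

theorem analyticAt_normal (hx : IsAnalyticSimpleClosedCurve x) (τ : ℝ) :
    AnalyticAt ℝ (normal x) τ := by
  have h1 := hx.analytic.deriv τ (mem_univ τ)
  have h2 : AnalyticAt ℝ (fun s => ‖deriv x s‖⁻¹) τ :=
    (analyticAt_norm h1 (hx.regular τ)).inv (norm_ne_zero_iff.2 (hx.regular τ))
  have h3 : ∀ v : Plane, !₂[v 1, -v 0]
      = toComplex.symm (-Complex.I * toComplex v) := by
    intro v
    rw [LinearIsometryEquiv.eq_symm_apply]
    apply Complex.ext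
    · rw [toComplex_re]
      simp [toComplex_im]
    · rw [toComplex_im]
      simp [toComplex_re]
  have h4 : AnalyticAt ℝ (fun s => toComplex.symm (-Complex.I * toComplex (deriv x s))) τ := by
    refine (toComplex.symm.toContinuousLinearEquiv.toContinuousLinearMap.analyticAt _).comp ?_
    exact analyticAt_const.mul
      ((toComplex.toContinuousLinearEquiv.toContinuousLinearMap.analyticAt _).comp h1)
  refine (h2.smul h4).congr (Eventually.of_forall fun s => ?_)
  simp only [normal, h3]
  rfl

theorem periodic_normal (hx : IsAnalyticSimpleClosedCurve x) :
    Function.Periodic (normal x) (2 * Real.pi) := fun τ => by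
  simp only [normal, periodic_deriv hx.periodic τ]

theorem inner_deriv_normal (t : ℝ) : inner ℝ (deriv x t) (normal x t) = 0 := by
  rw [normal, inner_smul_right, inner_eq_toComplex]
  simp only [toComplex_re, toComplex_im]
  simp
  right
  ring

theorem inner_normal_self (hx : IsAnalyticSimpleClosedCurve x) (t : ℝ) :
    inner ℝ (normal x t) (normal x t) = 1 := by
  rw [real_inner_self_eq_norm_sq, ← toComplex.norm_map, toComplex_normal]
  simp [hx.regular t]

theorem dslope_ne_zero (hx : IsAnalyticSimpleClosedCurve x) (t : ℝ) : dslope x t t ≠ 0 := by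
  rw [dslope_same]
  exact hx.regular t

theorem eventually_sameParam_iff (t : ℝ) : ∀ᶠ τ in 𝓝 t, SameParam τ t ↔ τ = t := by
  have hpi := Real.pi_pos
  filter_upwards [Ioo_mem_nhds (show t - 2 * Real.pi < t by linarith)
    (show t < t + 2 * Real.pi by linarith)] with τ hτ
  refine ⟨fun h => h.eq_of_abs_lt ?_, ?_⟩
  · rw [abs_lt]
    constructor <;> linarith [hτ.1, hτ.2]
  · rintro rfl
    exact SameParam.refl τ

variable {φ : ℝ → ℝ} {U : Plane → range x → ℝ}

theorem periodic_kernelP (hx : IsAnalyticSimpleClosedCurve x)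
    (hφ : Function.Periodic φ (2 * Real.pi)) (t : ℝ) :
    Function.Periodic (fun τ => kernelP x φ U τ t) (2 * Real.pi) := fun τ => by
  simp only [kernelP, hx.periodic_normal τ, hx.periodic τ, hφ τ,
    dirichletTrace]
  congr 1
  exact propext sameParam_add_period_iff

theorem periodic_kernelQ (hx : IsAnalyticSimpleClosedCurve x) (t : ℝ) :
    Function.Periodic (fun τ => kernelQ x U τ t) (2 * Real.pi) := fun τ => by
  simp only [kernelQ, hx.periodic_normal τ, hx.periodic τ,
    neumannTrace]
  congr 1
  exact propext sameParam_add_period_iff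

/-- With x(τ) - x(t) = (τ - t) D, the double pole of the bracket cancels against the double zero of
φ - P. At t the second fraction vanishes by orthogonality, leaving 1/(2π|x'|²) times half the second
derivative. -/
theorem analyticOnNhd_kernelP (hx : IsAnalyticSimpleClosedCurve x)
    (hφper : Function.Periodic φ (2 * Real.pi)) {t : ℝ}
    (hg : AnalyticOnNhd ℝ (fun s => φ s - dirichletTrace x U s t) univ)
    (hg0 : φ t - dirichletTrace x U t t = 0)
    (hg1 : deriv (fun s => φ s - dirichletTrace x U s t) t = 0) :
    AnalyticOnNhd ℝ (fun τ => kernelP x φ U τ t) univ := by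
  have hpi := Real.pi_pos
  refine analyticOnNhd_of_periodic (hx.periodic_kernelP hφper t) (t := t) ?_ ?_
  · set g : ℝ → ℝ := fun s => φ s - dirichletTrace x U s t with hgdef
    set D := dslope x t with hD
    have hDa := analyticOnNhd_dslope hx.analytic t t (mem_univ t)
    have hD0 := hx.dslope_ne_zero t
    have hga := analyticOnNhd_dslope hg t
    have hψ := analyticOnNhd_dslope hga t
    have hgψ : ∀ τ, g τ = (τ - t) ^ 2 * dslope (dslope g t) t τ := by
      intro τ
      have h1 := sub_smul_dslope g t τ
      have h2 := sub_smul_dslope (dslope g t) t τ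
      rw [dslope_same, hg1, sub_zero, smul_eq_mul] at h2
      rw [smul_eq_mul] at h1
      have h3 : g t = 0 := hg0
      linear_combination -h1 + h3 - (τ - t) * h2
    have hψt : dslope (dslope g t) t t = 1 / 2 * iteratedDeriv 2 g t := by
      rw [dslope_same, iteratedDeriv_succ, iteratedDeriv_one,
        deriv_deriv_eq_two_smul_deriv_dslope hg, smul_eq_mul]
      ring
    have hnorm := analyticAt_norm hDa hD0
    have hn0 : ‖dslope x t t‖ ≠ 0 := norm_ne_zero_iff.2 hD0
    have hν := hx.analyticAt_normal t
    have hνt : AnalyticAt ℝ (fun _ : ℝ => normal x t) t := analyticAt_const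
    have h1 : AnalyticAt ℝ (fun τ => (inner ℝ (normal x τ) (normal x t)
        / (2 * Real.pi * ‖D τ‖ ^ 2) - inner ℝ (D τ) (normal x t) * inner ℝ (D τ) (normal x τ)
          / (Real.pi * ‖D τ‖ ^ 4)) * dslope (dslope g t) t τ) t :=
      (((analyticAt_inner hν hνt).div (analyticAt_const.mul (hnorm.pow 2))
        (mul_ne_zero (by positivity) (pow_ne_zero 2 hn0))).sub
        (((analyticAt_inner hDa hνt).mul (analyticAt_inner hDa hν)).div
          (analyticAt_const.mul (hnorm.pow 4)) (mul_ne_zero hpi.ne' (pow_ne_zero 4 hn0)))).mul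
        (hψ t (mem_univ t))
    refine h1.congr ?_
    filter_upwards [eventually_sameParam_iff t, hDa.continuousAt.eventually_ne hD0] with τ hτ hDτ
    have hDn : ‖D τ‖ ≠ 0 := norm_ne_zero_iff.2 hDτ
    simp only [kernelP, hτ]
    split_ifs with h
    · rw [h, hψt, hD, dslope_same, inner_deriv_normal, hx.inner_normal_self]
      ring
    · have hτt : τ - t ≠ 0 := sub_ne_zero.2 h
      have h2 : x t - x τ = -((τ - t) • D τ) := by
        rw [hD, sub_smul_dslope, neg_sub]
      have h3 : ‖x t - x τ‖ ^ 2 = (τ - t) ^ 2 * ‖D τ‖ ^ 2 := by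
        rw [h2, norm_neg, norm_smul, mul_pow, Real.norm_eq_abs, sq_abs]
      have h4 : ‖x t - x τ‖ ^ 4 = (τ - t) ^ 4 * ‖D τ‖ ^ 4 := by
        calc ‖x t - x τ‖ ^ 4 = (‖x t - x τ‖ ^ 2) ^ 2 := by ring
          _ = _ := by rw [h3]; ring
      have h5 : φ τ - dirichletTrace x U τ t = (τ - t) ^ 2 * dslope (dslope g t) t τ := hgψ τ
      rw [h3, h4, h5, h2, inner_neg_left, inner_neg_left, inner_smul_left, inner_smul_left]
      simp only [conj_trivial]
      field_simp
  · intro τ hτ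
    have hxa := hx.analytic τ (mem_univ τ)
    have hν := hx.analyticAt_normal τ
    have hνt : AnalyticAt ℝ (fun _ : ℝ => normal x t) τ := analyticAt_const
    have hd : AnalyticAt ℝ (fun s => x t - x s) τ := analyticAt_const.sub hxa
    have hd0 : x t - x τ ≠ 0 := by
      rw [hx.sameParam_iff] at hτ
      exact sub_ne_zero.2 (Ne.symm hτ)
    have hnorm := analyticAt_norm hd hd0
    have hn0 : ‖x t - x τ‖ ≠ 0 := norm_ne_zero_iff.2 hd0
    have h1 := (((analyticAt_inner hν hνt).div
        ((analyticAt_const (v := 2 * Real.pi)).mul (hnorm.pow 2))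
        (mul_ne_zero (by positivity) (pow_ne_zero 2 hn0))).sub
        (((analyticAt_inner hd hνt).mul (analyticAt_inner hd hν)).div
          ((analyticAt_const (v := Real.pi)).mul (hnorm.pow 4))
          (mul_ne_zero hpi.ne' (pow_ne_zero 4 hn0)))).mul (hg τ (mem_univ τ))
    refine h1.congr ?_
    filter_upwards [hx.eventually_not_sameParam hτ] with s hs
    simp only [kernelP, if_neg hs]
    rfl

/-- The tangent is orthogonal to the normal, so the numerator (x(t) - x(τ)) · n(t) has a double zero
matching that of the squared distance. Its coefficient is half the normal component of x'', up to
sign. -/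
theorem analyticOnNhd_kernelQ (hx : IsAnalyticSimpleClosedCurve x) {t : ℝ}
    (hQ : AnalyticOnNhd ℝ (fun τ => neumannTrace x U τ t) univ) :
    AnalyticOnNhd ℝ (fun τ => kernelQ x U τ t) univ := by
  have hpi := Real.pi_pos
  refine analyticOnNhd_of_periodic (hx.periodic_kernelQ t) (t := t) ?_ ?_
  · set D := dslope x t with hD
    have hDon := analyticOnNhd_dslope hx.analytic t
    have hDa := hDon t (mem_univ t)
    have hD0 := hx.dslope_ne_zero t
    set e : ℝ → ℝ := fun τ => inner ℝ (D τ) (normal x t) with he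
    have hea : AnalyticOnNhd ℝ e univ := fun τ hτ =>
      analyticAt_inner (hDon τ hτ) analyticAt_const
    have hEa := analyticOnNhd_dslope hea t
    have het : e t = 0 := by
      rw [he, hD]
      simp only
      rw [dslope_same, inner_deriv_normal]
    have heE : ∀ τ, e τ = (τ - t) * dslope e t τ := by
      intro τ
      have h1 := sub_smul_dslope e t τ
      rw [het, sub_zero, smul_eq_mul] at h1
      exact h1.symm
    have hEt : dslope e t t = 1 / 2 * inner ℝ (deriv (deriv x) t) (normal x t) := by
      have h1 : HasDerivAt e (inner ℝ (deriv D t) (normal x t)) t := by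
        have h2 := (hasDerivAt_of_analyticOnNhd hDon t).inner ℝ (hasDerivAt_const t (normal x t))
        simpa using h2
      rw [dslope_same, h1.deriv, deriv_deriv_eq_two_smul_deriv_dslope hx.analytic,
        inner_smul_left, hD]
      simp
    have hnorm := analyticAt_norm hDa hD0
    have hn0 : ‖dslope x t t‖ ≠ 0 := norm_ne_zero_iff.2 hD0
    have h1 : AnalyticAt ℝ (fun τ => 1 / (2 * Real.pi) * (dslope e t τ / ‖D τ‖ ^ 2)
        * neumannTrace x U τ t) t :=
      (analyticAt_const.mul ((hEa t (mem_univ t)).div (hnorm.pow 2) (pow_ne_zero 2 hn0))).mul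
        (hQ t (mem_univ t))
    refine h1.congr ?_
    filter_upwards [eventually_sameParam_iff t, hDa.continuousAt.eventually_ne hD0] with τ hτ hDτ
    have hDn : ‖D τ‖ ≠ 0 := norm_ne_zero_iff.2 hDτ
    simp only [kernelQ, hτ]
    split_ifs with h
    · rw [h, hEt, hD, dslope_same]
      ring
    · have hτt : τ - t ≠ 0 := sub_ne_zero.2 h
      have h2 : x t - x τ = -((τ - t) • D τ) := by
        rw [hD, sub_smul_dslope, neg_sub]
      have h3 : ‖x t - x τ‖ ^ 2 = (τ - t) ^ 2 * ‖D τ‖ ^ 2 := by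
        rw [h2, norm_neg, norm_smul, mul_pow, Real.norm_eq_abs, sq_abs]
      have h5 : inner ℝ (x t - x τ) (normal x t) = -((τ - t) * ((τ - t) * dslope e t τ)) := by
        rw [← heE, h2, inner_neg_left, inner_smul_left]
        rfl
      rw [h3, h5]
      field_simp
  · intro τ hτ
    have hd : AnalyticAt ℝ (fun s => x t - x s) τ :=
      analyticAt_const.sub (hx.analytic τ (mem_univ τ))
    have hd0 : x t - x τ ≠ 0 := by
      rw [hx.sameParam_iff] at hτ
      exact sub_ne_zero.2 (Ne.symm hτ)
    have h1 := ((analyticAt_const (v := -(1 / (2 * Real.pi)))).mul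
      ((analyticAt_inner hd (analyticAt_const (v := normal x t))).div
        ((analyticAt_norm hd hd0).pow 2) (pow_ne_zero 2 (norm_ne_zero_iff.2 hd0)))).mul
      (hQ τ (mem_univ τ))
    refine h1.congr ?_
    filter_upwards [hx.eventually_not_sameParam hτ] with s hs
    simp only [kernelQ, if_neg hs]
    rfl

end IsAnalyticSimpleClosedCurve

/-! ### Interpolation conditions, splitting of the integrand, and conclusion. -/

/-- Derivatives of an analytic function are continuous, so the punctured limits are values. -/
theorem InterpolatesToOrder.iteratedDeriv_eq_zero {M : ℕ} {P : ℝ → ℝ → ℝ} {φ : ℝ → ℝ}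
    (h : InterpolatesToOrder M P φ) {t : ℝ} (ha : AnalyticOnNhd ℝ (fun τ => P τ t - φ τ) univ)
    {m : ℕ} (hm : m ≤ M) : iteratedDeriv m (fun τ => P τ t - φ τ) t = 0 := by
  have h1 : ContinuousAt (iteratedDeriv m (fun τ => P τ t - φ τ)) t := by
    have h2 := ha.iterated_deriv m
    rw [← iteratedDeriv_eq_iterate] at h2
    exact (h2 t (mem_univ t)).continuousAt
  exact tendsto_nhds_unique (h1.tendsto.mono_left nhdsWithin_le_nhds) (h t m hm)

/-- The integrand of the hypersingular operator, split into a dipole potential acting on the real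
part of an entire function and the kernels `kernelP` and `kernelQ`. -/
theorem IsAnalyticSimpleClosedCurve.hypersingular_integrand_eq {x : ℝ → Plane}
    (hx : IsAnalyticSimpleClosedCurve x) (φ : ℝ → ℝ) {U : Plane → range x → ℝ} {τ t : ℝ}
    (hτ : ¬SameParam τ t) {f : ℂ → ℂ} (hf : Differentiable ℂ f)
    (hU : ∀ q, U q ⟨x t, mem_range_self t⟩ = (f (toComplex q)).re) :
    hypersingularKernel x τ t * φ τ * ‖deriv x τ‖
      = -(1 / (2 * Real.pi)) * (toComplex (normal x t) * deriv (fun s => toComplex (x s)) τ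
          / (toComplex (x τ) - toComplex (x t)) ^ 2).im * (f (toComplex (x τ))).re
        - 1 / (2 * Real.pi) * (toComplex (normal x t) / (toComplex (x τ) - toComplex (x t))).re
          * (deriv f (toComplex (x τ)) * deriv (fun s => toComplex (x s)) τ).im
        + (kernelP x φ U τ t + kernelQ x U τ t) * ‖deriv x τ‖ := by
  have hne : x t ≠ x τ := fun h => hτ (hx.sameParam_iff.2 h.symm)
  have hP : kernelP x φ U τ t
      = hypersingularKernel x τ t * (φ τ - (f (toComplex (x τ))).re) := by
    rw [kernelP, if_neg hτ, ← hypersingularKernel_eq hne, dirichletTrace, hU]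
  have hdip : -(1 / (2 * Real.pi)) * (inner ℝ (x t - x τ) (normal x t) / ‖x t - x τ‖ ^ 2)
      = 1 / (2 * Real.pi)
        * (toComplex (normal x t) / (toComplex (x τ) - toComplex (x t))).re := by
    rw [norm_sub_rev, ← neg_sub (x τ), inner_neg_left, inner_eq_toComplex, ← map_sub,
      Complex.div_re, Complex.normSq_eq_norm_sq, LinearIsometryEquiv.norm_map]
    ring
  have hn : (‖deriv x τ‖ : ℂ) ≠ 0 := by
    exact_mod_cast norm_ne_zero_iff.2 (hx.regular τ)
  -- The unnormalised normal is -i z', and Re(-i w) = Im w.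
  have hQ : neumannTrace x U τ t * ‖deriv x τ‖
      = (deriv f (toComplex (x τ)) * deriv (fun s => toComplex (x s)) τ).im := by
    rw [neumannTrace_eq hf hU, toComplex_normal, LinearIsometryEquiv.norm_map, hx.deriv_toComplex,
      ← Complex.re_mul_ofReal]
    have h1 : deriv f (toComplex (x τ)) * (-Complex.I * toComplex (deriv x τ) / ‖deriv x τ‖)
        * ‖deriv x τ‖ = -Complex.I * (deriv f (toComplex (x τ)) * toComplex (deriv x τ)) := by
      field_simp
    rw [h1]
    simp
  rw [← hx.hypersingularKernel_mul_norm hne, ← hdip, ← hQ, hP, kernelQ, if_neg hτ]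
  ring

end HDI

end

theorem lemma2p1
    (x : ℝ → HDI.Plane) (hx : HDI.IsAnalyticSimpleClosedCurve x)
    (φ : ℝ → ℝ) (hφ : AnalyticOnNhd ℝ φ Set.univ) (hφper : Function.Periodic φ (2 * Real.pi))
    (U : HDI.Plane → Set.range x → ℝ)
    (hU : ∀ y : Set.range x,
      InnerProductSpace.HarmonicOnNhd (fun p => U p y) Set.univ)
    (M : ℕ) (hM : 1 ≤ M)
    (hP : HDI.InterpolatesToOrder M (HDI.dirichletTrace x U) φ) :
    ∀ t : ℝ,
      HDI.HasHypersingularValue x φ t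
        (-HDI.neumannTrace x U t t / 2
          + ∫ τ in (0 : ℝ)..(2 * Real.pi),
              (HDI.kernelP x φ U τ t + HDI.kernelQ x U τ t) * ‖deriv x τ‖)
      ∧ AnalyticOnNhd ℝ (fun τ => HDI.kernelP x φ U τ t) Set.univ
      ∧ Function.Periodic (fun τ => HDI.kernelP x φ U τ t) (2 * Real.pi)
      ∧ AnalyticOnNhd ℝ (fun τ => HDI.kernelQ x U τ t) Set.univ
      ∧ Function.Periodic (fun τ => HDI.kernelQ x U τ t) (2 * Real.pi) := by
  intro t
  have hpi := Real.pi_pos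
  obtain ⟨f, hf, hUf, hf0⟩ := HDI.exists_entire_re_eq (hU ⟨x t, Set.mem_range_self t⟩)
    (HDI.toComplex (x t))
  have hz := hx.isRegularLoop
  have hfz : ∀ g : ℂ → ℂ, Differentiable ℂ g →
      AnalyticOnNhd ℝ (fun τ => g (HDI.toComplex (x τ))) Set.univ := fun g hg τ _ =>
    ((hg.analyticAt (HDI.toComplex (x τ))).restrictScalars (𝕜 := ℝ)).comp_of_eq
      (hz.analytic τ (Set.mem_univ τ)) rfl
  have hPa : AnalyticOnNhd ℝ (fun τ => HDI.dirichletTrace x U τ t) Set.univ := by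
    intro τ hτ
    refine ((Complex.reCLM.analyticAt _).comp (hfz f hf τ hτ)).congr
      (Filter.Eventually.of_forall fun s => ?_)
    exact (hUf (x s)).symm
  have hQa : AnalyticOnNhd ℝ (fun τ => HDI.neumannTrace x U τ t) Set.univ := by
    intro τ hτ
    have h1 := (HDI.toComplex.toContinuousLinearEquiv.toContinuousLinearMap.analyticAt
      (HDI.normal x τ)).comp (hx.analyticAt_normal τ)
    refine ((Complex.reCLM.analyticAt _).comp ((hfz (deriv f) hf.deriv τ hτ).mul h1)).congr
      (Filter.Eventually.of_forall fun s => ?_)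
    exact (HDI.neumannTrace_eq hf hUf s).symm
  have hneg : (fun s => φ s - HDI.dirichletTrace x U s t)
      = -fun s => HDI.dirichletTrace x U s t - φ s := by
    funext s
    simp
  have hKP : AnalyticOnNhd ℝ (fun τ => HDI.kernelP x φ U τ t) Set.univ := by
    -- Matching in orders 0 and 1 is the double zero of φ - P at t.
    refine hx.analyticOnNhd_kernelP hφper (hφ.sub hPa) ?_ ?_
    · have h1 := hP.iteratedDeriv_eq_zero (t := t) (hPa.sub hφ) (Nat.zero_le M)
      simp only [iteratedDeriv_zero] at h1
      linarith
    · have h1 := hP.iteratedDeriv_eq_zero (t := t) (hPa.sub hφ) hM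
      rw [iteratedDeriv_one] at h1
      rw [hneg, deriv.neg, h1, neg_zero]
  have hKQ := hx.analyticOnNhd_kernelQ hQa
  have hKPper := hx.periodic_kernelP (U := U) hφper t
  have hKQper := hx.periodic_kernelQ (U := U) t
  refine ⟨?_, hKP, hKPper, hKQ, hKQper⟩
  have hx'per := HDI.periodic_deriv hx.periodic
  have hx'c : Continuous (deriv x) := continuous_iff_continuousAt.2 fun τ =>
    (hx.analytic.deriv τ (Set.mem_univ τ)).continuousAt
  have hrc : Continuous fun τ => (HDI.kernelP x φ U τ t + HDI.kernelQ x U τ t) * ‖deriv x τ‖ :=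
    ((continuousOn_univ.1 hKP.continuousOn).add (continuousOn_univ.1 hKQ.continuousOn)).mul
      hx'c.norm
  have hrper : Function.Periodic
      (fun τ => (HDI.kernelP x φ U τ t + HDI.kernelQ x U τ t) * ‖deriv x τ‖) (2 * Real.pi) := by
    intro τ
    have h1 := hKPper τ
    have h2 := hKQper τ
    simp only at h1 h2
    simp only [h1, h2, hx'per τ]
  have hint : ∫ τ in (0 : ℝ)..(2 * Real.pi),
      (HDI.kernelP x φ U τ t + HDI.kernelQ x U τ t) * ‖deriv x τ‖
      = ∫ τ in (t - Real.pi)..(t + Real.pi),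
        (HDI.kernelP x φ U τ t + HDI.kernelQ x U τ t) * ‖deriv x τ‖ := by
    have h1 := hrper.intervalIntegral_add_eq 0 (t - Real.pi)
    rw [zero_add] at h1
    rw [h1]
    congr 1
    ring
  have hkper : Function.Periodic
      (fun τ => HDI.hypersingularKernel x τ t * φ τ * ‖deriv x τ‖) (2 * Real.pi) := by
    intro τ
    simp only [HDI.hypersingularKernel, hx'per τ, hφper τ, hx.periodic τ, hx.periodic_normal τ]
  have key := hz.hasFinitePart_dipole (hx.chordAngle_eq_pi t)
    (ν := HDI.toComplex (HDI.normal x t))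
    (by rw [HDI.toComplex_normal, hx.deriv_toComplex]) hf hf0 hkper hrc.continuousOn (by
      intro τ hτ hτt
      refine hx.hypersingular_integrand_eq φ (fun h => hτt (h.eq_of_abs_lt ?_)) hf hUf
      rw [abs_lt]
      constructor <;> linarith [hτ.1, hτ.2])
  rw [hint, HDI.neumannTrace_eq hf hUf, mul_comm (deriv f _)]
  simp only [← map_sub, LinearIsometryEquiv.norm_map] at key
  exact key
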